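/- For a two-qubit state \(\omega\) let \(F(\omega)=\max_{\phi}\langle\phi|\omega|\phi\rangle\), the maximum over maximally entangled two-qubit vectors \(\phi\), and let \(F^\star(\omega)=\sup_\Lambda F(\Lambda(\omega))\), the supremum over trace-preserving finite-round LOCC maps \(\Lambda\) between the two parties with two-qubit output. For \(p\in(0,1)\), \(\delta\in[1/2,1)\) and orthonormal qubit bases \(\{\psi,\psi^\perp\}\), \(\{\phi,\phi^\perp\}\), let \[ \rho(p,\delta)=p\,|\psi\phi\rangle\langle\psi\phi|+(1-p)\,|\zeta(\delta)\rangle\langle\zeta(\delta)|,\qquad |\zeta(\delta)\rangle=\sqrt{\delta}\,|\psi\rangle|\phi^\perp\rangle+\sqrt{1-\delta}\,|\psi^\perp\rangle|\phi\rangle . \] Consider a repeater chain Alice \(=N_0, N_1,\dots,N_n, N_{n+1}=\) Bob with segments \(S_1,\dots,S_{n+1}\), where \(S_i\) holds a two-qubit state shared by \(N_{i-1}\) and \(N_i\). The first segment \(S_1\) holds \(\rho(p,\delta)\), and for \(i=2,\dots,n+1\) the segment \(S_i\) holds a pure entangled state with Schmidt coefficients \(\sqrt{\alpha_i},\sqrt{1-\alpha_i}\),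 \(\alpha_i\in[1/2,1)\) (in arbitrary local bases), so that its concurrence is \(C_i=2\sqrt{\alpha_i(1-\alpha_i)}\). Let \(F^\star_{AB}\) be the supremum of \(F(\Lambda(\eta))\), where \(\eta\) is the joint state of all segments and \(\Lambda\) ranges over the finite-round LOCC protocols among all \(n+2\) parties that leave one qubit with Alice and one with Bob. Then, for all given \(\alpha_2,\dots,\alpha_{n+1}\), the region of noise parameters \[ R=\Big\{(p,\delta)\in(0,1)\times[\tfrac12,1):\ \frac{1+\sqrt{1-\prod_{i=2}^{n+1}C_i^2}}{2}\le\frac{p^2}{p^2+\delta(1-\delta)(1-p)^2}\Big\} \] has nonempty interior in \(\mathbb R^2\), and for every \((p,\delta)\in R\) one has \(F^\star_{AB}=F^\star(\rho(p,\delta))\), and some LOCC protocol \(\Lambda\) on the chain achieves this value, \(F(\Lambda(\eta))=F^\star(\rho(p,\delta))\). -/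

import Mathlib

open scoped BigOperators Matrix

noncomputable section

namespace Repeater

/-! ### Multipartite systems and LOCC

Party `k` holds a finite-dimensional system with orthonormal basis labelled by `d k`; joint
operators are matrices indexed by the joint labels `∀ k, d k`. -/

section LOCC

variable {P : Type} [Fintype P] [DecidableEq P]

/-- The tensor product `⊗ₖ K k` of local operators. -/
def prodOp {d m : P → Type} (K : ∀ k, Matrix (m k) (d k) ℂ) :
    Matrix (∀ k, m k) (∀ k, d k) ℂ :=
  Matrix.of fun y x => ∏ k, K k (y k) (x k)

/-- The action `ρ ↦ K ρ Kᴴ` of a (Kraus) operator. -/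
def conjBy {a b : Type} [Fintype a] (K : Matrix b a ℂ) (ρ : Matrix a a ℂ) : Matrix b b ℂ :=
  K * ρ * Kᴴ

/-- The operators `K x` are the Kraus operators of a quantum operation: `∑ₓ (K x)ᴴ (K x) = 1`. -/
def IsKrausFamily {X a b : Type} [Fintype X] [Fintype b] [DecidableEq a]
    (K : X → Matrix b a ℂ) : Prop :=
  ∑ x, (K x)ᴴ * K x = 1

/-- Deterministic (trace-preserving) LOCC maps with finitely many rounds of communication, from
the joint system `d` to the joint system `d'`.

* `localOps`: without further communication every party `k` applies a local channel, with Kraus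
  operators `L k y`.
* `round`: party `k` performs a measurement with Kraus operators `K x k`, obtains the outcome `x`
  and announces it to everybody; the other parties apply isometries `K x j` (doing nothing,
  applying a unitary, adding an ancilla); then the parties continue with an LOCC protocol `Λ x`
  that may depend on `x`. -/
inductive IsLOCC {d' : P → Type} [∀ k, Fintype (d' k)] :
    ∀ {d : P → Type} [∀ k, Fintype (d k)] [∀ k, DecidableEq (d k)],
      (Matrix (∀ k, d k) (∀ k, d k) ℂ → Matrix (∀ k, d' k) (∀ k, d' k) ℂ) → Prop
  | localOps {d : P → Type} [∀ k, Fintype (d k)] [∀ k, DecidableEq (d k)]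
      (Y : P → Type) [∀ k, Fintype (Y k)]
      (L : ∀ k, Y k → Matrix (d' k) (d k) ℂ) (hL : ∀ k, IsKrausFamily (L k)) :
      IsLOCC (fun ρ => ∑ y : ∀ k, Y k, conjBy (prodOp fun k => L k (y k)) ρ)
  | round {d m : P → Type} [∀ k, Fintype (d k)] [∀ k, DecidableEq (d k)]
      [∀ k, Fintype (m k)] [∀ k, DecidableEq (m k)]
      (k : P) (X : Type) [Fintype X]
      (K : X → ∀ j, Matrix (m j) (d j) ℂ)
      (hk : IsKrausFamily fun x => K x k)
      (hj : ∀ x, ∀ j, j ≠ k → (K x j)ᴴ * K x j = 1)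
      (Λ : X → Matrix (∀ k, m k) (∀ k, m k) ℂ → Matrix (∀ k, d' k) (∀ k, d' k) ℂ)
      (hΛ : ∀ x, IsLOCC (Λ x)) :
      IsLOCC (fun ρ => ∑ x, Λ x (conjBy (prodOp (K x)) ρ))

end LOCC

/-! ### Qubits and who owns them -/

/-- Basis labels of the system of party `k`, when the qubit `q` belongs to party `owner q`. -/
abbrev QubitSys {Q P : Type} (owner : Q → P) (k : P) : Type := {q : Q // owner q = k} → Fin 2

/-- Joint state of the parties, from a matrix indexed by the values of all the qubits. -/
def distribute {Q P : Type} (owner : Q → P) (ω : Matrix (Q → Fin 2) (Q → Fin 2) ℂ) :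
    Matrix (∀ k, QubitSys owner k) (∀ k, QubitSys owner k) ℂ :=
  ω.submatrix (fun x q => x (owner q) ⟨q, rfl⟩) (fun x q => x (owner q) ⟨q, rfl⟩)

/-- Inverse of `distribute`: the matrix indexed by the values of all the qubits. -/
def collect {Q P : Type} (owner : Q → P)
    (τ : Matrix (∀ k, QubitSys owner k) (∀ k, QubitSys owner k) ℂ) :
    Matrix (Q → Fin 2) (Q → Fin 2) ℂ :=
  τ.submatrix (fun w _ q => w q.1) (fun w _ q => w q.1)

/-! ### Two-qubit states -/

/-- Orthonormal bases of a qubit. -/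
abbrev QubitBasis : Type := OrthonormalBasis (Fin 2) ℂ (EuclideanSpace ℂ (Fin 2))

/-- Vectors of two qubits; the label `w` stands for the basis vector `|w 0⟩|w 1⟩`. -/
abbrev Ket2 : Type := (Fin 2 → Fin 2) → ℂ

/-- Operators on two qubits. -/
abbrev Op2 : Type := Matrix (Fin 2 → Fin 2) (Fin 2 → Fin 2) ℂ

/-- The product vector `|ψ⟩|φ⟩`. -/
def tensorKet (ψ φ : EuclideanSpace ℂ (Fin 2)) : Ket2 := fun w => ψ (w 0) * φ (w 1)

/-- The operator `|ψ⟩⟨ψ|`. -/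
def ketbra (ψ : Ket2) : Op2 := Matrix.vecMulVec ψ (star ψ)

/-- The vector `√α |e₀⟩|f₀⟩ + √(1-α) |e₁⟩|f₁⟩` with Schmidt coefficients `√α`, `√(1-α)`. -/
def schmidtKet (e f : QubitBasis) (α : ℝ) : Ket2 :=
  ((√α : ℝ) : ℂ) • tensorKet (e 0) (f 0) + ((√(1 - α) : ℝ) : ℂ) • tensorKet (e 1) (f 1)

/-- The noisy state `ρ(p,δ) = p |P⟩⟨P| + (1-p) |ζ(δ)⟩⟨ζ(δ)|`, where `|P⟩ = |ψ⟩|φ⟩` and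
`|ζ(δ)⟩ = √δ |ψ⟩|φ^⊥⟩ + √(1-δ) |ψ^⊥⟩|φ⟩`, with `u = (ψ, ψ^⊥)` and `v = (φ, φ^⊥)`. -/
def noisyState (u v : QubitBasis) (p δ : ℝ) : Op2 :=
  (p : ℂ) • ketbra (tensorKet (u 0) (v 0)) +
    ((1 - p : ℝ) : ℂ) • ketbra
      (((√δ : ℝ) : ℂ) • tensorKet (u 0) (v 1) + ((√(1 - δ) : ℝ) : ℂ) • tensorKet (u 1) (v 0))

/-! ### Fully entangled fractions -/

/-- Fully entangled fraction `F(X)`: the maximum of `⟨φ|X|φ⟩` over the maximally entangled `φ`. -/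
def fef (X : Op2) : ℝ :=
  sSup {t : ℝ | ∃ e f : QubitBasis,
    t = (star (schmidtKet e f (1 / 2)) ⬝ᵥ (X *ᵥ schmidtKet e f (1 / 2))).re}

/-- The values `F(Λ(ω))`, where `Λ` runs over the LOCC protocols among all parties `P` that start
from the qubits `Q`, in the joint state `ω`, and end with one qubit at party `A` and one qubit at
party `B` (all other systems being discarded). -/
def achievableFEF {Q P : Type} [Fintype Q] [DecidableEq Q] [Fintype P] [DecidableEq P]
    (owner : Q → P) (A B : P) (ω : Matrix (Q → Fin 2) (Q → Fin 2) ℂ) : Set ℝ :=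
  {t : ℝ | ∃ Λ : Matrix (∀ k, QubitSys owner k) (∀ k, QubitSys owner k) ℂ →
      Matrix (∀ k, QubitSys ![A, B] k) (∀ k, QubitSys ![A, B] k) ℂ,
    IsLOCC Λ ∧ t = fef (collect ![A, B] (Λ (distribute owner ω)))}

/-- Optimal fully entangled fraction `F^⋆(ρ)` of a two-qubit state shared by two parties. -/
def ofef (ρ : Op2) : ℝ := sSup (achievableFEF (id : Fin 2 → Fin 2) 0 1 ρ)

/-! ### The repeater chain

Parties `0, 1, …, n+1` are Alice, the `n` nodes, and Bob. Segment `s` consists of a qubit `(s, 0)`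
at party `s` and a qubit `(s, 1)` at party `s + 1`. -/

/-- The party that holds a qubit of the chain. -/
def chainOwner (n : ℕ) (q : Fin (n + 1) × Fin 2) : Fin (n + 2) :=
  ![q.1.castSucc, q.1.succ] q.2

/-- The product `⊗ₛ ρ s` of the states of the segments. -/
def chainState {n : ℕ} (ρ : Fin (n + 1) → Op2) :
    Matrix (Fin (n + 1) × Fin 2 → Fin 2) (Fin (n + 1) × Fin 2 → Fin 2) ℂ :=
  Matrix.of fun x y => ∏ s, ρ s (fun i => x (s, i)) (fun i => y (s, i))

/-- The fully entangled fractions that LOCC among all parties can establish between the ends. -/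
def chainAchievableFEF {n : ℕ} (ρ : Fin (n + 1) → Op2) : Set ℝ :=
  achievableFEF (chainOwner n) 0 (Fin.last (n + 1)) (chainState ρ)

/-- The optimal end-to-end fully entangled fraction `F^⋆_AB`. -/
def chainOFEF {n : ℕ} (ρ : Fin (n + 1) → Op2) : ℝ := sSup (chainAchievableFEF ρ)

/-- The states of the segments when the first one is noisy, in the state `ρ₁`, and the other `n`
hold the pure states with Schmidt bases `e i`, `f i` and Schmidt coefficients
`√(α i)`, `√(1 - α i)`. -/
def segmentStates {n : ℕ} (ρ₁ : Op2) (e f : Fin n → QubitBasis) (α : Fin n → ℝ) :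
    Fin (n + 1) → Op2 :=
  Fin.cons ρ₁ fun i => ketbra (schmidtKet (e i) (f i) (α i))

/-- Concurrence of a pure two-qubit state with Schmidt coefficients `√α`, `√(1-α)`. -/
def concurrence (α : ℝ) : ℝ := 2 * √(α * (1 - α))

/-- The explicit region of noise parameters `(p, δ)`. -/
def noiseRegion {n : ℕ} (α : Fin n → ℝ) : Set (ℝ × ℝ) :=
  {x : ℝ × ℝ | x.1 ∈ Set.Ioo 0 1 ∧ x.2 ∈ Set.Ico (1 / 2) 1 ∧
    (1 + √(1 - ∏ i, concurrence (α i) ^ 2)) / 2 ≤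
      x.1 ^ 2 / (x.1 ^ 2 + x.2 * (1 - x.2) * (1 - x.1) ^ 2)}

end Repeater

end

/-! Both optimal fractions equal `optValue p δ`, that is (1 + (1-p)²δ(1-δ)/p)/2. This follows from
one upper bound that ignores the pure segments and one protocol that loses nothing to them.

Upper bound. Adding a suitable multiple z of |ψ^⊥φ^⊥⟩ as a rank-one term turns ρ(p,δ) into a mixture
of four product vectors (`noisyState_add_eq_sum`). LOCC keeps product vectors product across the cut
between Alice and the rest, and a product vector overlaps a maximally entangled one by at most half
its squared norm. So no protocol exceeds half the total weight 1 + ‖z‖², which is `optValue`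
(`fid_le_of_separable`, `sum_nrm_sepKet`). Normalised pure segments among the other parties change
neither the product structure nor the weight, so the bound holds for the pair and for the chain.

Protocol. The pure segments are swapped from Bob's end in mutually unbiased Schmidt bases: all four
outcomes are equally likely and squared concurrences multiply (`exists_unbiased_swap`,
`attains_chain`). The first node then measures in a Bell basis aligned with {φ, φ^⊥} and with the
Schmidt basis of the remaining pure state (`attains_last_swap`). Alice and Bob get a copy of ρ(p,δ)
whose Bob-side vectors have squared norms S and T, the two Schmidt weights in one order or the
other. Alice filters; on failure a product state is prepared (`attains_filter`). The gain
`outcomeValue` is linear in (S, T), so averaging over the two orders gives the balanced value. The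
filter is a contraction in both orders exactly when the larger Schmidt weight satisfies the
inequality that defines the region (`Sufficient.balanced`). -/

noncomputable section

set_option linter.unusedSectionVars false

namespace Repeater

/-! ### Pure states, Kraus operators and overlaps -/

section Vectors

variable {a b : Type} [Fintype a] [Fintype b]

/-- The operator `|v⟩⟨v|`. -/
def rankOne (v : a → ℂ) : Matrix a a ℂ := Matrix.vecMulVec v (star v)

/-- Squared norm of a vector. -/
def nrm (v : a → ℂ) : ℝ := ∑ x, ‖v x‖ ^ 2

lemma star_dotProduct_self (v : a → ℂ) : star v ⬝ᵥ v = (nrm v : ℂ) := by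
  simp only [dotProduct, nrm, Complex.ofReal_sum, Pi.star_apply]
  refine Finset.sum_congr rfl fun x _ => ?_
  rw [Complex.star_def, Complex.conj_mul']
  push_cast
  rfl

lemma conjBy_rankOne (K : Matrix b a ℂ) (v : a → ℂ) :
    conjBy K (rankOne v) = rankOne (K *ᵥ v) := by
  rw [conjBy, rankOne, rankOne, Matrix.mul_vecMulVec, Matrix.vecMulVec_mul, Matrix.star_mulVec]

lemma conjBy_add (K : Matrix b a ℂ) (ρ σ : Matrix a a ℂ) :
    conjBy K (ρ + σ) = conjBy K ρ + conjBy K σ := by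
  simp [conjBy, Matrix.mul_add, Matrix.add_mul]

lemma nrm_kraus {X : Type} [Fintype X] [DecidableEq a] (K : X → Matrix b a ℂ)
    (hK : IsKrausFamily K) (v : a → ℂ) : ∑ x, nrm (K x *ᵥ v) = nrm v := by
  have h : ∀ x, ((nrm (K x *ᵥ v) : ℝ) : ℂ) = star v ⬝ᵥ (((K x)ᴴ * K x) *ᵥ v) := by
    intro x
    rw [← star_dotProduct_self, Matrix.star_mulVec, ← Matrix.mulVec_mulVec,
      Matrix.dotProduct_mulVec (star v)]
  have h2 : ((∑ x, nrm (K x *ᵥ v) : ℝ) : ℂ) = nrm v := by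
    rw [← star_dotProduct_self]
    push_cast
    simp_rw [h]
    rw [← dotProduct_sum, ← Matrix.sum_mulVec, hK, Matrix.one_mulVec]
  exact_mod_cast h2

/-- The expectation value `⟨φ|X|φ⟩`. -/
def fid (φ : a → ℂ) (X : Matrix a a ℂ) : ℝ := (star φ ⬝ᵥ (X *ᵥ φ)).re

lemma fid_add (φ : a → ℂ) (X Y : Matrix a a ℂ) : fid φ (X + Y) = fid φ X + fid φ Y := by
  simp [fid, Matrix.add_mulVec, dotProduct_add]

lemma fid_rankOne (φ v : a → ℂ) : fid φ (rankOne v) = ‖star φ ⬝ᵥ v‖ ^ 2 := by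
  rw [fid, rankOne, Matrix.vecMulVec_mulVec]
  have : star v ⬝ᵥ φ = star (star φ ⬝ᵥ v) := by
    rw [← Matrix.star_dotProduct_star, star_star, dotProduct_comm]
  rw [this, dotProduct_smul]
  simp only [MulOpposite.smul_eq_mul_unop, MulOpposite.unop_op]
  rw [Complex.star_def, Complex.mul_conj', ← Complex.ofReal_pow, Complex.ofReal_re]

end Vectors

/-! ### Products of local operators -/

section ProdOp

variable {P : Type} [Fintype P] [DecidableEq P]

lemma prodOp_one {d : P → Type} [∀ k, DecidableEq (d k)] :
    prodOp (fun k => (1 : Matrix (d k) (d k) ℂ)) = 1 := by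
  ext y x
  simp only [prodOp, Matrix.of_apply, Matrix.one_apply]
  by_cases h : y = x
  · simp [h]
  · obtain ⟨k, hk⟩ := Function.ne_iff.mp h
    rw [if_neg h]
    exact Finset.prod_eq_zero (Finset.mem_univ k) (if_neg hk)

lemma prodOp_conjTranspose {d m : P → Type} (K : ∀ k, Matrix (m k) (d k) ℂ) :
    (prodOp K)ᴴ = prodOp fun k => (K k)ᴴ := by
  ext y x
  simp [prodOp, Matrix.conjTranspose_apply]

lemma prodOp_mul {d m l : P → Type} [∀ k, Fintype (m k)] (K : ∀ k, Matrix (l k) (m k) ℂ)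
    (L : ∀ k, Matrix (m k) (d k) ℂ) : prodOp K * prodOp L = prodOp fun k => K k * L k := by
  ext y x
  simp only [prodOp, Matrix.mul_apply, Matrix.of_apply, ← Finset.prod_mul_distrib]
  rw [Finset.prod_univ_sum, Fintype.piFinset_univ]

lemma sum_prodOp {d m : P → Type} {Y : P → Type} [∀ k, Fintype (Y k)]
    (L : ∀ k, Y k → Matrix (m k) (d k) ℂ) :
    ∑ y : ∀ k, Y k, prodOp (fun k => L k (y k)) = prodOp fun k => ∑ y, L k y := by
  ext y x
  simp only [prodOp, Matrix.sum_apply, Matrix.of_apply]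
  rw [Finset.prod_univ_sum, Fintype.piFinset_univ]

lemma isKrausFamily_prodOp {d m : P → Type} [∀ k, Fintype (m k)] [∀ k, DecidableEq (d k)]
    {Y : P → Type} [∀ k, Fintype (Y k)] (L : ∀ k, Y k → Matrix (m k) (d k) ℂ)
    (hL : ∀ k, IsKrausFamily (L k)) :
    IsKrausFamily fun y : ∀ k, Y k => prodOp fun k => L k (y k) := by
  unfold IsKrausFamily at *
  simp only [prodOp_conjTranspose, prodOp_mul]
  rw [sum_prodOp (fun k y => (L k y)ᴴ * L k y)]
  simp only [hL, prodOp_one]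

/-- Factors other than `k` are isometries for each outcome, so their Gram matrices are the identity
whatever `x` is; the sum over outcomes acts on factor `k` alone. -/
lemma isKrausFamily_round {d m : P → Type} [∀ k, Fintype (m k)] [∀ k, DecidableEq (d k)]
    (k : P) {X : Type} [Fintype X] (K : X → ∀ j, Matrix (m j) (d j) ℂ)
    (hk : IsKrausFamily fun x => K x k) (hj : ∀ x, ∀ j, j ≠ k → (K x j)ᴴ * K x j = 1) :
    IsKrausFamily fun x => prodOp (K x) := by
  unfold IsKrausFamily at *
  simp only [prodOp_conjTranspose, prodOp_mul]
  rw [← prodOp_one]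
  ext y z
  simp only [Matrix.sum_apply, prodOp, Matrix.of_apply]
  rw [← Finset.mul_prod_erase _ _ (Finset.mem_univ k), ← hk, Matrix.sum_apply, Finset.sum_mul]
  refine Finset.sum_congr rfl fun x _ => ?_
  rw [← Finset.mul_prod_erase _ _ (Finset.mem_univ k)]
  congr 1
  refine Finset.prod_congr rfl fun j hj' => ?_
  rw [hj x j (Finset.ne_of_mem_erase hj')]

end ProdOp

/-! ### Bounds preserved by LOCC -/

section Locc

variable {P : Type} [Fintype P] [DecidableEq P] {d' : P → Type} [∀ k, Fintype (d' k)]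
  {d : P → Type} [∀ k, Fintype (d k)] [∀ k, DecidableEq (d k)]
  {Λ : Matrix (∀ k, d k) (∀ k, d k) ℂ → Matrix (∀ k, d' k) (∀ k, d' k) ℂ}

lemma IsLOCC.map_add (h : IsLOCC Λ) (ρ σ : Matrix (∀ k, d k) (∀ k, d k) ℂ) :
    Λ (ρ + σ) = Λ ρ + Λ σ := by
  induction h with
  | localOps Y L hL => simp only [conjBy_add, Finset.sum_add_distrib]
  | round k X K hk hj Λ hΛ ih => simp only [conjBy_add, ih, Finset.sum_add_distrib]

lemma IsLOCC.map_sum (h : IsLOCC Λ) {ι : Type} [Nonempty ι] [Fintype ι]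
    (ρ : ι → Matrix (∀ k, d k) (∀ k, d k) ℂ) : Λ (∑ i, ρ i) = ∑ i, Λ (ρ i) := by
  classical
  have h0 : Λ 0 = 0 := by simpa using h.map_add 0 0
  exact _root_.map_sum (AddMonoidHom.mk' Λ h.map_add) ρ Finset.univ

/-- `v` is a product vector with respect to the cut between `A` and the other parties. -/
def IsProductAt {d : P → Type} (A : P) (v : (∀ k, d k) → ℂ) : Prop :=
  ∃ (f : d A → ℂ) (g : (∀ j : {j // j ≠ A}, d j) → ℂ), ∀ x, v x = f (x A) * g fun j => x j

/-- A product operator splits into a factor at `A` and a factor on the rest, and each acts on its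
own factor of the vector. Arbitrary local operators are allowed, so every Kraus branch is covered.
-/
lemma IsProductAt.prodOp_mulVec {m : P → Type} {A : P} {v : (∀ k, d k) → ℂ}
    (hv : IsProductAt A v) (K : ∀ k, Matrix (m k) (d k) ℂ) : IsProductAt A (prodOp K *ᵥ v) := by
  obtain ⟨f, g, hfg⟩ := hv
  refine ⟨K A *ᵥ f, fun y => ∑ x : ∀ j : {j // j ≠ A}, d j,
    (∏ j : {j // j ≠ A}, K j (y j) (x j)) * g x, ?_⟩
  intro y
  simp only [Matrix.mulVec, dotProduct, prodOp, Matrix.of_apply, hfg]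
  rw [Finset.sum_mul_sum, ← Fintype.sum_prod_type',
    ← (Equiv.piSplitAt A d).sum_comp]
  refine Finset.sum_congr rfl fun x _ => ?_
  rw [Fintype.prod_eq_mul_prod_subtype_ne _ A]
  simp only [Equiv.piSplitAt, Equiv.coe_fn_mk]
  ring

/-- A functional that is nonnegative on pure states stays so after LOCC. -/
lemma IsLOCC.nonneg (h : IsLOCC Λ) (ℓ : Matrix (∀ k, d' k) (∀ k, d' k) ℂ →+ ℝ)
    (hℓ : ∀ w, 0 ≤ ℓ (rankOne w)) (v : (∀ k, d k) → ℂ) : 0 ≤ ℓ (Λ (rankOne v)) := by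
  induction h with
  | localOps Y L hL =>
    simp only [conjBy_rankOne, _root_.map_sum]
    exact Finset.sum_nonneg fun y _ => hℓ _
  | round k X K hk hj Λ hΛ ih =>
    simp only [conjBy_rankOne, _root_.map_sum]
    exact Finset.sum_nonneg fun y _ => ih _ _

/-- LOCC maps send product vectors to mixtures of product vectors and preserve the norm. -/
lemma IsLOCC.le_of_isProductAt (h : IsLOCC Λ) (A : P)
    (ℓ : Matrix (∀ k, d' k) (∀ k, d' k) ℂ →+ ℝ) (c : ℝ)
    (hℓ : ∀ w, IsProductAt A w → ℓ (rankOne w) ≤ c * nrm w) (v : (∀ k, d k) → ℂ)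
    (hv : IsProductAt A v) : ℓ (Λ (rankOne v)) ≤ c * nrm v := by
  induction h with
  | localOps Y L hL =>
    simp only [conjBy_rankOne, _root_.map_sum]
    -- Completeness distributes the squared norm over the outcomes, so the bound can be checked
    -- branch by branch.
    rw [← nrm_kraus _ (isKrausFamily_prodOp L hL) v, Finset.mul_sum]
    exact Finset.sum_le_sum fun y _ => hℓ _ (hv.prodOp_mulVec _)
  | round k X K hk hj Λ hΛ ih =>
    simp only [conjBy_rankOne, _root_.map_sum]
    rw [← nrm_kraus _ (isKrausFamily_round k K hk hj) v, Finset.mul_sum]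
    exact Finset.sum_le_sum fun y _ => ih _ _ (hv.prodOp_mulVec _)

end Locc

/-! ### Overlap of product and maximally entangled vectors -/

lemma nrm_basis (e : QubitBasis) (a : Fin 2 → ℂ) :
    ∑ i, ‖∑ j, star (e i j) * a j‖ ^ 2 = ∑ j, ‖a j‖ ^ 2 := by
  have h := e.sum_sq_norm_inner_right (WithLp.toLp 2 a)
  rw [EuclideanSpace.norm_sq_eq] at h
  rw [← h]
  refine Finset.sum_congr rfl fun i _ => ?_
  congr 2
  simp [PiLp.inner_apply, mul_comm]

lemma basis_inner (e : QubitBasis) (i j : Fin 2) :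
    ∑ a, star (e i a) * e j a = if i = j then 1 else 0 := by
  have h := orthonormal_iff_ite.mp e.orthonormal i j
  rw [← h]
  simp [PiLp.inner_apply, mul_comm]

lemma sum_ket {M : Type} [AddCommMonoid M] (F : (Fin 2 → Fin 2) → M) :
    ∑ w, F w = ∑ a, ∑ b, F ![a, b] := by
  rw [← (finTwoArrowEquiv (Fin 2)).symm.sum_comp, Fintype.sum_prod_type]
  rfl

/-- The overlap of a product vector with a maximally entangled vector is at most `1/2`. -/
lemma fid_product_le (e f : QubitBasis) (a b : Fin 2 → ℂ) :
    fid (schmidtKet e f (1 / 2)) (rankOne fun w => a (w 0) * b (w 1)) ≤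
      1 / 2 * nrm (fun w : Fin 2 → Fin 2 => a (w 0) * b (w 1)) := by
  have hn : nrm (fun w : Fin 2 → Fin 2 => a (w 0) * b (w 1)) =
      (∑ j, ‖a j‖ ^ 2) * ∑ j, ‖b j‖ ^ 2 := by
    rw [nrm, sum_ket]
    simp [Fin.sum_univ_two, mul_pow]
    ring
  rw [hn, ← nrm_basis e a, ← nrm_basis f b, fid_rankOne]
  have hs : star (schmidtKet e f (1 / 2)) ⬝ᵥ (fun w : Fin 2 → Fin 2 => a (w 0) * b (w 1)) =
      ((√(1 / 2) : ℝ) : ℂ) * ∑ i, (∑ j, star (e i j) * a j) * ∑ j, star (f i j) * b j := by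
    rw [dotProduct, sum_ket]
    have h12 : (1 - 1 / 2 : ℝ) = 1 / 2 := by norm_num
    simp only [schmidtKet, tensorKet, h12, Fin.sum_univ_two, Pi.star_apply, Pi.add_apply,
      Pi.smul_apply, smul_eq_mul, star_add, star_mul', Matrix.cons_val_zero, Matrix.cons_val_one,
      Complex.star_def, Complex.conj_ofReal]
    ring
  rw [hs, norm_mul, mul_pow, Complex.norm_real, Real.norm_eq_abs, sq_abs,
    Real.sq_sqrt (by norm_num)]
  refine mul_le_mul_of_nonneg_left ?_ (by norm_num)
  calc _ ≤ (∑ i, ‖∑ j, star (e i j) * a j‖ * ‖∑ j, star (f i j) * b j‖) ^ 2 := by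
        gcongr
        refine (norm_sum_le _ _).trans (Finset.sum_le_sum fun i _ => ?_)
        rw [norm_mul]
    _ ≤ _ := Finset.sum_mul_sq_le_sq_mul_sq _ _ _

/-! ### Relabelling between qubits and parties -/

section Collect

variable {Q P : Type}

/-- Labels of joint basis vectors of the parties, from the values of the qubits. -/
def scatter (owner : Q → P) (w : Q → Fin 2) : ∀ k, QubitSys owner k := fun _ q => w q.1

/-- Values of the qubits, from the labels of the systems of the parties. -/
def gather (owner : Q → P) (x : ∀ k, QubitSys owner k) : Q → Fin 2 := fun q => x (owner q) ⟨q, rfl⟩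

lemma gather_scatter (owner : Q → P) (w : Q → Fin 2) : gather owner (scatter owner w) = w := rfl

lemma scatter_gather (owner : Q → P) (x : ∀ k, QubitSys owner k) :
    scatter owner (gather owner x) = x := by
  funext k ⟨q, hq⟩
  subst hq
  rfl

/-- The joint labels of the qubits and of the parties correspond. -/
def scatterEquiv (owner : Q → P) : (Q → Fin 2) ≃ ∀ k, QubitSys owner k :=
  ⟨scatter owner, gather owner, gather_scatter owner, scatter_gather owner⟩

lemma distribute_rankOne (owner : Q → P) (v : (Q → Fin 2) → ℂ) :
    distribute owner (rankOne v) = rankOne fun x => v (gather owner x) := rfl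

variable [Fintype Q] [Fintype P] [DecidableEq P] [DecidableEq Q]

lemma nrm_scatter (owner : Q → P) (v : (∀ k, QubitSys owner k) → ℂ) :
    nrm (fun w => v (scatter owner w)) = nrm v :=
  (scatterEquiv owner).sum_comp fun x => ‖v x‖ ^ 2

lemma nrm_gather (owner : Q → P) (v : (Q → Fin 2) → ℂ) :
    nrm (fun x => v (gather owner x)) = nrm v :=
  (scatterEquiv owner).symm.sum_comp fun x => ‖v x‖ ^ 2

end Collect

/-! ### Upper bound from a separable majorant -/

section UpperBound

variable {Q P : Type} [Fintype Q] [DecidableEq Q] [Fintype P] [DecidableEq P]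

/-- The functional `τ ↦ ⟨φ|τ|φ⟩` on operators of the two output qubits. -/
def endFid (A B : P) (φ : Ket2) :
    Matrix (∀ k, QubitSys ![A, B] k) (∀ k, QubitSys ![A, B] k) ℂ →+ ℝ :=
  AddMonoidHom.mk' (fun τ => fid φ (collect ![A, B] τ)) fun τ τ' => by
    rw [← fid_add]; rfl

lemma endFid_rankOne (A B : P) (φ : Ket2) (w : (∀ k, QubitSys ![A, B] k) → ℂ) :
    endFid A B φ (rankOne w) = fid φ (rankOne fun z => w (scatter ![A, B] z)) := rfl

lemma endFid_nonneg (A B : P) (φ : Ket2) (w : (∀ k, QubitSys ![A, B] k) → ℂ) :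
    0 ≤ endFid A B φ (rankOne w) := by
  rw [endFid_rankOne, fid_rankOne]
  positivity

/-- At the end `A` holds exactly output qubit 0 and the other parties together hold qubit 1, so the
cut between `A` and the rest is the cut between the two output qubits. -/
lemma endFid_le_of_isProductAt {A B : P} (hAB : A ≠ B) (e f : QubitBasis)
    (w : (∀ k, QubitSys ![A, B] k) → ℂ) (hw : IsProductAt A w) :
    endFid A B (schmidtKet e f (1 / 2)) (rankOne w) ≤ 1 / 2 * nrm w := by
  obtain ⟨g, h, hgh⟩ := hw
  have hv : (fun z => w (scatter ![A, B] z)) =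
      fun z : Fin 2 → Fin 2 => g (fun _ => z 0) * h (fun _ _ => z 1) := by
    funext z
    rw [hgh]
    congr 2
    · funext q
      obtain ⟨q, hq⟩ := q
      fin_cases q
      · rfl
      · exact absurd hq.symm hAB
    · funext j q
      obtain ⟨q, hq⟩ := q
      fin_cases q
      · exact absurd hq.symm j.2
      · rfl
  rw [endFid_rankOne, ← nrm_scatter, hv]
  exact fid_product_le e f (fun i => g fun _ => i) fun i => h fun _ _ => i

/-- If a state becomes a mixture of product vectors after adding a positive operator, then the
fully entangled fraction after LOCC is at most half the weight of this mixture. -/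
lemma fid_le_of_separable {owner : Q → P} {A B : P} (hAB : A ≠ B)
    {ω : Matrix (Q → Fin 2) (Q → Fin 2) ℂ} {ι : Type} [Fintype ι] [Nonempty ι]
    (z : (Q → Fin 2) → ℂ) (V : ι → (Q → Fin 2) → ℂ) (hV : ω + rankOne z = ∑ i, rankOne (V i))
    (hprod : ∀ i, IsProductAt A fun x => V i (gather owner x))
    {Λ : Matrix (∀ k, QubitSys owner k) (∀ k, QubitSys owner k) ℂ →
      Matrix (∀ k, QubitSys ![A, B] k) (∀ k, QubitSys ![A, B] k) ℂ} (hΛ : IsLOCC Λ)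
    (e f : QubitBasis) :
    fid (schmidtKet e f (1 / 2)) (collect ![A, B] (Λ (distribute owner ω))) ≤
      1 / 2 * ∑ i, nrm (V i) := by
  have h1 : distribute owner ω + rankOne (fun x => z (gather owner x)) =
      ∑ i, rankOne fun x => V i (gather owner x) := by
    rw [← distribute_rankOne]
    have h2 : distribute owner ω + distribute owner (rankOne z) =
      distribute owner (∑ i, rankOne (V i)) := by rw [← hV]; rfl
    rw [h2]
    ext x y
    simp [distribute, Matrix.sum_apply, rankOne, Matrix.vecMulVec_apply]
    rfl
  set ℓ := endFid A B (schmidtKet e f (1 / 2)) with hℓ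
  -- The added positive term can only increase the fidelity, so it may be dropped from the upper
  -- bound.
  have h3 := hΛ.nonneg ℓ (endFid_nonneg A B _) fun x => z (gather owner x)
  have h4 : ℓ (Λ (distribute owner ω)) + ℓ (Λ (rankOne fun x => z (gather owner x))) =
      ∑ i, ℓ (Λ (rankOne fun x => V i (gather owner x))) := by
    rw [← map_add, ← hΛ.map_add, h1, hΛ.map_sum, map_sum]
  have h5 : ∀ i, ℓ (Λ (rankOne fun x => V i (gather owner x))) ≤ 1 / 2 * nrm (V i) := by
    intro i
    rw [← nrm_gather owner (V i)]
    exact hΛ.le_of_isProductAt A ℓ (1 / 2) (endFid_le_of_isProductAt hAB e f) _ (hprod i)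
  change ℓ (Λ (distribute owner ω)) ≤ _
  rw [Finset.mul_sum]
  linarith [Finset.sum_le_sum fun i (_ : i ∈ Finset.univ) => h5 i]

/-- The optimum is determined by an upper bound for all protocols and all target vectors and one
protocol that attains it for one target vector. -/
lemma sSup_achievableFEF {owner : Q → P} {A B : P} {ω : Matrix (Q → Fin 2) (Q → Fin 2) ℂ} {c : ℝ}
    (hle : ∀ Λ : Matrix (∀ k, QubitSys owner k) (∀ k, QubitSys owner k) ℂ →
      Matrix (∀ k, QubitSys ![A, B] k) (∀ k, QubitSys ![A, B] k) ℂ, IsLOCC Λ →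
      ∀ e f : QubitBasis,
        fid (schmidtKet e f (1 / 2)) (collect ![A, B] (Λ (distribute owner ω))) ≤ c)
    (hatt : ∃ Λ : Matrix (∀ k, QubitSys owner k) (∀ k, QubitSys owner k) ℂ →
      Matrix (∀ k, QubitSys ![A, B] k) (∀ k, QubitSys ![A, B] k) ℂ, IsLOCC Λ ∧
      ∃ e f : QubitBasis,
        fid (schmidtKet e f (1 / 2)) (collect ![A, B] (Λ (distribute owner ω))) = c) :
    c ∈ achievableFEF owner A B ω ∧ sSup (achievableFEF owner A B ω) = c := by
  have h1 : ∀ Λ : Matrix (∀ k, QubitSys owner k) (∀ k, QubitSys owner k) ℂ →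
      Matrix (∀ k, QubitSys ![A, B] k) (∀ k, QubitSys ![A, B] k) ℂ, IsLOCC Λ →
      ∀ t ∈ {t : ℝ | ∃ e f : QubitBasis, t = (star (schmidtKet e f (1 / 2)) ⬝ᵥ
        (collect ![A, B] (Λ (distribute owner ω)) *ᵥ schmidtKet e f (1 / 2))).re}, t ≤ c := by
    rintro Λ hΛ t ⟨e, f, rfl⟩
    exact hle Λ hΛ e f
  have h2 : ∀ t ∈ achievableFEF owner A B ω, t ≤ c := by
    rintro t ⟨Λ, hΛ, rfl⟩
    exact csSup_le ⟨_, EuclideanSpace.basisFun _ _, EuclideanSpace.basisFun _ _, rfl⟩ (h1 Λ hΛ)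
  have h3 : c ∈ achievableFEF owner A B ω := by
    obtain ⟨Λ, hΛ, e, f, hef⟩ := hatt
    have h : IsGreatest {t : ℝ | ∃ e f : QubitBasis, t = (star (schmidtKet e f (1 / 2)) ⬝ᵥ
        (collect ![A, B] (Λ (distribute owner ω)) *ᵥ schmidtKet e f (1 / 2))).re} c :=
      ⟨⟨e, f, hef.symm⟩, h1 Λ hΛ⟩
    exact ⟨Λ, hΛ, h.csSup_eq.symm⟩
  have h4 : IsGreatest (achievableFEF owner A B ω) c := ⟨h3, h2⟩
  exact ⟨h3, h4.csSup_eq⟩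

end UpperBound

/-! ### States of the chain -/

/-- The product vector `⊗ₛ ψ s` on the qubits of the segments. -/
def chainVec {n : ℕ} (ψ : Fin (n + 1) → Ket2) : (Fin (n + 1) × Fin 2 → Fin 2) → ℂ :=
  fun x => ∏ s, ψ s fun i => x (s, i)

lemma nrm_chainVec {n : ℕ} (ψ : Fin (n + 1) → Ket2) : nrm (chainVec ψ) = ∏ s, nrm (ψ s) := by
  simp only [nrm, chainVec]
  rw [Finset.prod_univ_sum, Fintype.piFinset_univ, ← (Equiv.curry _ _ _).symm.sum_comp]
  refine Finset.sum_congr rfl fun x _ => ?_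
  rw [norm_prod, ← Finset.prod_pow]
  rfl

lemma chainState_cons_sum {n : ℕ} {ι : Type} [Fintype ι] (ψ : ι → Ket2) (φ : Fin n → Ket2) :
    chainState (Fin.cons (∑ r, rankOne (ψ r)) fun i => ketbra (φ i)) =
      ∑ r, rankOne (chainVec (Fin.cons (ψ r) φ : Fin (n + 1) → Ket2)) := by
  ext x y
  simp only [chainState, Matrix.of_apply, Fin.prod_univ_succ, Fin.cons_zero, Fin.cons_succ,
    Matrix.sum_apply, rankOne, chainVec, Matrix.vecMulVec_apply, Pi.star_apply, Finset.sum_mul,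
    ketbra, star_mul', star_prod]
  refine Finset.sum_congr rfl fun r _ => ?_
  rw [Finset.prod_mul_distrib]
  ring

/-- Alice owns only the qubit `(0, 0)`; once the first segment is a product, all remaining
amplitudes belong to the other parties. -/
lemma isProductAt_chainVec {n : ℕ} (a b : Fin 2 → ℂ) (φ : Fin n → Ket2) :
    IsProductAt 0 fun x => chainVec (Fin.cons (fun w => a (w 0) * b (w 1)) φ : Fin (n + 1) → Ket2)
      (gather (chainOwner n) x) := by
  refine ⟨fun z => a (z ⟨(0, 0), rfl⟩), fun z =>
    b (z ⟨(0 : Fin (n + 1)).succ, Fin.succ_ne_zero _⟩ ⟨(0, 1), rfl⟩) *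
      ∏ s : Fin n, φ s ![z ⟨s.succ.castSucc, by simp [Fin.ext_iff]⟩ ⟨(s.succ, 0), rfl⟩,
        z ⟨s.succ.succ, Fin.succ_ne_zero _⟩ ⟨(s.succ, 1), rfl⟩], fun x => ?_⟩
  simp only [chainVec, Fin.prod_univ_succ, Fin.cons_zero, Fin.cons_succ]
  rw [mul_assoc]
  refine congrArg₂ (· * ·) rfl (congrArg₂ (· * ·) rfl
    (Finset.prod_congr rfl fun s _ => congrArg (φ s) ?_))
  funext i
  fin_cases i <;> rfl

lemma isProductAt_pair (a b : Fin 2 → ℂ) :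
    IsProductAt 0 fun x => (fun w : Fin 2 → Fin 2 => a (w 0) * b (w 1))
      (gather (id : Fin 2 → Fin 2) x) :=
  ⟨fun z => a (z ⟨0, rfl⟩), fun z => b (z ⟨1, by simp⟩ ⟨1, rfl⟩), fun _ => rfl⟩

/-- Matrix of the amplitudes of a two-qubit vector. -/
def ketMat (ψ : Ket2) : Matrix (Fin 2) (Fin 2) ℂ := Matrix.of fun a b => ψ ![a, b]

/-- The unitary matrix whose columns are the vectors of a basis. -/
def basisMat (u : QubitBasis) : Matrix (Fin 2) (Fin 2) ℂ := Matrix.of fun a i => u i a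

lemma basisMat_conjTranspose_mul (u : QubitBasis) : (basisMat u)ᴴ * basisMat u = 1 := by
  ext i j
  simp only [Matrix.mul_apply, Matrix.conjTranspose_apply, basisMat, Matrix.of_apply,
    Matrix.one_apply]
  exact basis_inner u i j

/-- The two (unnormalised) pure states mixed in `noisyState u v p δ`. -/
def noisyKet (u v : QubitBasis) (p δ : ℝ) : Fin 2 → Ket2 :=
  ![((√p : ℝ) : ℂ) • tensorKet (u 0) (v 0),
    ((√(1 - p) : ℝ) : ℂ) • (((√δ : ℝ) : ℂ) • tensorKet (u 0) (v 1) +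
      ((√(1 - δ) : ℝ) : ℂ) • tensorKet (u 1) (v 0))]

lemma rankOne_real_smul {a : Type} (r : ℝ) (hr : 0 ≤ r) (v : a → ℂ) :
    rankOne (((√r : ℝ) : ℂ) • v) = (r : ℂ) • rankOne v := by
  ext x y
  have h : ((√r : ℝ) : ℂ) * ((√r : ℝ) : ℂ) = r := by
    rw [← Complex.ofReal_mul, Real.mul_self_sqrt hr]
  simp only [rankOne, Matrix.vecMulVec_apply, Pi.smul_apply, Pi.star_apply, smul_eq_mul,
    star_mul', Matrix.smul_apply, ← h, Complex.star_def, Complex.conj_ofReal]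
  ring

lemma noisyState_eq_sum (u v : QubitBasis) {p δ : ℝ} (hp : p ∈ Set.Ioo 0 1) :
    noisyState u v p δ = ∑ r, rankOne (noisyKet u v p δ r) := by
  rw [Fin.sum_univ_two]
  simp only [noisyKet, Matrix.cons_val_zero, Matrix.cons_val_one]
  rw [rankOne_real_smul _ hp.1.le, rankOne_real_smul _ (by linarith [hp.2])]
  rfl

/-! ### Separable majorant of the noisy state -/

/-- The value of the optimal fully entangled fraction of the noisy state. -/
def optValue (p δ : ℝ) : ℝ := 1 / 2 * (1 + (1 - p) ^ 2 * (δ * (1 - δ)) / p)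

lemma nrm_two_terms (u : QubitBasis) (r s : ℂ) :
    ∑ j, ‖r * u 0 j + s * u 1 j‖ ^ 2 = ‖r‖ ^ 2 + ‖s‖ ^ 2 := by
  rw [← nrm_basis u]
  have h : ∀ i, ∑ j, star (u i j) * (r * u 0 j + s * u 1 j) =
      r * (if i = 0 then 1 else 0) + s * (if i = 1 then 1 else 0) := by
    intro i
    rw [← basis_inner u i 0, ← basis_inner u i 1, Finset.mul_sum, Finset.mul_sum,
      ← Finset.sum_add_distrib]
    exact Finset.sum_congr rfl fun j _ => by ring
  simp_rw [h]
  simp [Fin.sum_univ_two]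

/-- Averaging over the phases `1, i, -1, -i`. -/
lemma sum_phases {a : Type} (x y z : a → ℂ) :
    rankOne x + rankOne y + rankOne z =
      ∑ k : Fin 4, rankOne ((1 / 2 : ℂ) • (x + Complex.I ^ (k : ℕ) • y +
        (Complex.I ^ (k : ℕ)) ^ 2 • z)) := by
  -- Cross terms carry odd powers of the phase, or its square up to conjugation, and these sum to
  -- zero over the four phases. The signs 1 and -1 alone would leave the cross terms of `x` with
  -- `z`.
  ext s t
  simp only [Fin.sum_univ_four, Matrix.add_apply, rankOne, Matrix.vecMulVec_apply, Pi.smul_apply,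
    Pi.star_apply, Pi.add_apply, smul_eq_mul, star_mul', star_add, Complex.star_def, map_pow,
    Complex.conj_I, map_div₀, map_one, Complex.conj_ofNat]
  simp only [Fin.val_zero, Fin.val_one, Fin.val_two, Fin.isValue, pow_zero,
    pow_one, one_mul, neg_sq, Complex.I_sq]
  have h3 : ((3 : Fin 4) : ℕ) = 3 := rfl
  rw [h3]
  have h4 : Complex.I ^ 3 = -Complex.I := by rw [pow_succ, Complex.I_sq]; ring
  have h5 : (-Complex.I) ^ 3 = Complex.I := by rw [neg_pow, h4]; ring
  rw [h4, h5]
  have hI := Complex.I_sq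
  ring_nf
  simp only [hI, h4, show Complex.I ^ 4 = 1 from Complex.I_pow_four]
  ring

/-- Factors of the product vectors that dominate the noisy state. -/
def sepLeft (u : QubitBasis) (p δ : ℝ) (k : Fin 4) : Fin 2 → ℂ := fun a =>
  (1 / 2 : ℂ) * u 0 a +
    (1 / 2 : ℂ) * (Complex.I ^ (k : ℕ) * ((√((1 - p) * (1 - δ) / p) : ℝ) : ℂ)) * u 1 a

/-- Factors of the product vectors that dominate the noisy state. -/
def sepRight (v : QubitBasis) (p δ : ℝ) (k : Fin 4) : Fin 2 → ℂ := fun b =>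
  ((√p : ℝ) : ℂ) * v 0 b + (Complex.I ^ (k : ℕ) * ((√((1 - p) * δ) : ℝ) : ℂ)) * v 1 b

/-- Product vectors whose mixture dominates the noisy state. -/
def sepKet (u v : QubitBasis) (p δ : ℝ) (k : Fin 4) : Ket2 :=
  fun w => sepLeft u p δ k (w 0) * sepRight v p δ k (w 1)

/-- All four phases give the same norm; their total is (1 + (1-p)(1-δ)/p)(p + (1-p)δ), which expands
to 1 + (1-p)²δ(1-δ)/p. -/
lemma sum_nrm_sepKet (u v : QubitBasis) {p δ : ℝ} (hp : p ∈ Set.Ioo 0 1)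
    (hδ : δ ∈ Set.Ico (1 / 2) 1) :
    1 / 2 * ∑ k, nrm (sepKet u v p δ k) = optValue p δ := by
  have h0 : 0 < p := hp.1
  have h1 : 0 < 1 - p := by linarith [hp.2]
  have h2 : 0 < 1 - δ := by linarith [hδ.2]
  have h3 : 0 < δ := by linarith [hδ.1]
  have h : ∀ k, nrm (sepKet u v p δ k) =
      (1 / 4 + 1 / 4 * ((1 - p) * (1 - δ) / p)) * (p + (1 - p) * δ) := by
    intro k
    have hn : nrm (sepKet u v p δ k) =
        (∑ j, ‖sepLeft u p δ k j‖ ^ 2) * ∑ j, ‖sepRight v p δ k j‖ ^ 2 := by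
      rw [nrm, sum_ket]
      simp [sepKet, Fin.sum_univ_two, mul_pow]
      ring
    rw [hn]
    simp only [sepLeft, sepRight]
    rw [nrm_two_terms, nrm_two_terms]
    simp only [norm_mul, norm_pow, Complex.norm_I, one_pow, one_mul, Complex.norm_real,
      Real.norm_eq_abs, sq_abs, mul_pow]
    rw [Real.sq_sqrt (by positivity), Real.sq_sqrt h0.le, Real.sq_sqrt (by positivity)]
    norm_num
  simp only [h, optValue, Finset.sum_const, Finset.card_univ, Fintype.card_fin, nsmul_eq_mul]
  push_cast
  field_simp
  ring

/-- Each product vector expands into a phase-free term √p |ψφ⟩, a term of phase i^k equal to √(1-p)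
|ζ(δ)⟩, and a term of phase i^(2k) along |ψ^⊥φ^⊥⟩. Averaging over k decouples them; the last one is
`z`. -/
lemma noisyState_add_eq_sum (u v : QubitBasis) {p δ : ℝ} (hp : p ∈ Set.Ioo 0 1)
    (hδ : δ ∈ Set.Ico (1 / 2) 1) :
    ∃ z : Ket2, noisyState u v p δ + rankOne z = ∑ k, rankOne (sepKet u v p δ k) := by
  have h0 : 0 < p := hp.1
  have h1 : 0 < 1 - p := by linarith [hp.2]
  have h2 : 0 < 1 - δ := by linarith [hδ.2]
  have h3 : 0 < δ := by linarith [hδ.1]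
  refine ⟨((√((1 - p) * (1 - δ) / p) * √((1 - p) * δ) : ℝ) : ℂ) • tensorKet (u 1) (v 1), ?_⟩
  rw [noisyState_eq_sum u v hp, Fin.sum_univ_two, sum_phases]
  refine Finset.sum_congr rfl fun k _ => ?_
  congr 1
  funext w
  have e1 : √((1 - p) * δ) = √(1 - p) * √δ := Real.sqrt_mul h1.le _
  have e2 : √((1 - p) * (1 - δ) / p) * √p = √(1 - p) * √(1 - δ) := by
    rw [← Real.sqrt_mul (by positivity), ← Real.sqrt_mul h1.le]
    congr 1
    field_simp
  have e2' : ((√((1 - p) * (1 - δ) / p) : ℝ) : ℂ) * ((√p : ℝ) : ℂ) =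
    ((√(1 - p) : ℝ) : ℂ) * ((√(1 - δ) : ℝ) : ℂ) := by exact_mod_cast e2
  simp only [noisyKet, Matrix.cons_val_zero, Matrix.cons_val_one, Pi.smul_apply, Pi.add_apply,
    smul_eq_mul, tensorKet, sepKet, sepLeft, sepRight, e1]
  push_cast
  linear_combination (-1 / 2 * Complex.I ^ (k : ℕ) * u 1 (w 0) * v 0 (w 1)) * e2'

/-- Upper bound for the fully entangled fractions on the chain. -/
lemma chain_fid_le (u v : QubitBasis) {p δ : ℝ} (hp : p ∈ Set.Ioo 0 1)
    (hδ : δ ∈ Set.Ico (1 / 2) 1) {n : ℕ} (φ : Fin n → Ket2) (hφ : ∀ i, nrm (φ i) = 1)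
    {Λ : Matrix (∀ k, QubitSys (chainOwner n) k) (∀ k, QubitSys (chainOwner n) k) ℂ →
      Matrix (∀ k, QubitSys ![0, Fin.last (n + 1)] k) (∀ k, QubitSys ![0, Fin.last (n + 1)] k) ℂ}
    (hΛ : IsLOCC Λ) (e f : QubitBasis) :
    fid (schmidtKet e f (1 / 2)) (collect ![0, Fin.last (n + 1)] (Λ (distribute (chainOwner n)
      (chainState (Fin.cons (noisyState u v p δ) fun i => ketbra (φ i)))))) ≤ optValue p δ := by
  obtain ⟨z, hz⟩ := noisyState_add_eq_sum u v hp hδ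
  have h := fid_le_of_separable (owner := chainOwner n) (A := 0) (B := Fin.last (n + 1))
    (ω := chainState (Fin.cons (noisyState u v p δ) fun i => ketbra (φ i)))
    (by simp [Fin.ext_iff])
    (chainVec (Fin.cons z φ : Fin (n + 1) → Ket2))
    (fun k => chainVec (Fin.cons (sepKet u v p δ k) φ : Fin (n + 1) → Ket2)) ?_
    (fun k => isProductAt_chainVec _ _ φ) hΛ e f
  · refine h.trans (le_of_eq ?_)
    rw [← sum_nrm_sepKet u v hp hδ]
    congr 1
    refine Finset.sum_congr rfl fun k _ => ?_
    rw [nrm_chainVec, Fin.prod_univ_succ]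
    simp [hφ]
  · rw [← chainState_cons_sum, ← hz]
    have h1 := chainState_cons_sum (fun _ : Unit => z) φ
    simp only [Finset.univ_unique, Finset.sum_singleton] at h1
    rw [← h1]
    ext x y
    simp [chainState, Fin.prod_univ_succ, add_mul]

lemma pair_fid_le (u v : QubitBasis) {p δ : ℝ} (hp : p ∈ Set.Ioo 0 1)
    (hδ : δ ∈ Set.Ico (1 / 2) 1)
    {Λ : Matrix (∀ k, QubitSys (id : Fin 2 → Fin 2) k) (∀ k, QubitSys (id : Fin 2 → Fin 2) k) ℂ →
      Matrix (∀ k, QubitSys ![(0 : Fin 2), 1] k) (∀ k, QubitSys ![(0 : Fin 2), 1] k) ℂ}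
    (hΛ : IsLOCC Λ) (e f : QubitBasis) :
    fid (schmidtKet e f (1 / 2)) (collect ![0, 1] (Λ (distribute id (noisyState u v p δ)))) ≤
      optValue p δ := by
  obtain ⟨z, hz⟩ := noisyState_add_eq_sum u v hp hδ
  rw [← sum_nrm_sepKet u v hp hδ]
  exact fid_le_of_separable (owner := (id : Fin 2 → Fin 2)) (A := 0) (B := 1) (by simp) z _ hz
    (fun k => isProductAt_pair _ _) hΛ e f

/-! ### Interior of the noise region -/

lemma concurrence_pos {α : ℝ} (hα : α ∈ Set.Ico (1 / 2 : ℝ) 1) : 0 < concurrence α := by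
  have h1 : 0 < α := by linarith [hα.1]
  have h2 : 0 < 1 - α := by linarith [hα.2]
  have := Real.sqrt_pos.mpr (mul_pos h1 h2)
  simp only [concurrence]
  linarith

/-- With β the left-hand side of the region's inequality, positive concurrences give 1/2 ≤ β < 1.
For β < p < 1 one has δ(1-δ)(1-p)² ≤ (1-p)/4 ≤ (1-β)p², so an open box lies in the region. -/
lemma interior_noiseRegion_nonempty {n : ℕ} (α : Fin n → ℝ)
    (hα : ∀ i, α i ∈ Set.Ico (1 / 2 : ℝ) 1) : (interior (noiseRegion α)).Nonempty := by
  set S := √(1 - ∏ i, concurrence (α i) ^ 2) with hS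
  have hpos : 0 < ∏ i, concurrence (α i) ^ 2 :=
    Finset.prod_pos fun i _ => pow_pos (concurrence_pos (hα i)) 2
  have hS0 : 0 ≤ S := Real.sqrt_nonneg _
  have hS1 : S < 1 := by
    rw [hS, Real.sqrt_lt' one_pos]
    linarith
  set β := (1 + S) / 2 with hβ
  have hsub : Set.Ioo β 1 ×ˢ Set.Ioo (1 / 2 : ℝ) 1 ⊆ noiseRegion α := by
    rintro ⟨p, δ⟩ ⟨⟨hp1, hp2⟩, hδ1, hδ2⟩
    simp only at hp1 hp2 hδ1 hδ2
    have hp : 1 / 2 < p := by linarith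
    refine ⟨⟨by simp only; linarith, hp2⟩, ⟨hδ1.le, hδ2⟩, ?_⟩
    simp only
    have h1 : δ * (1 - δ) ≤ 1 / 4 := by nlinarith [sq_nonneg (δ - 1 / 2)]
    have h2 : 0 < δ * (1 - δ) := mul_pos (by linarith) (by linarith)
    have hd : 0 < p ^ 2 + δ * (1 - δ) * (1 - p) ^ 2 := by positivity
    rw [← hS, ← hβ, le_div_iff₀ hd]
    have h3 : δ * (1 - δ) * (1 - p) ^ 2 ≤ 1 / 4 * (1 - p) := by
      have : (1 - p) ^ 2 ≤ 1 - p := by nlinarith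
      calc _ ≤ 1 / 4 * (1 - p) ^ 2 := by gcongr
        _ ≤ _ := by gcongr
    have h4 : β * (δ * (1 - δ) * (1 - p) ^ 2) ≤ 1 * (1 / 4 * (1 - p)) :=
      mul_le_mul (by linarith) h3 (by positivity) zero_le_one
    have h5 : (1 - p) * (1 / 4) ≤ (1 - β) * p ^ 2 :=
      mul_le_mul (by linarith) (by nlinarith) (by norm_num) (by linarith)
    nlinarith
  refine Set.Nonempty.mono (interior_maximal hsub (isOpen_Ioo.prod isOpen_Ioo)) ?_
  refine Set.Nonempty.prod (Set.nonempty_Ioo.mpr (by linarith)) (Set.nonempty_Ioo.mpr (by norm_num))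

/-! ### Measurements by a single party -/

section ApplyAt

variable {P D : Type} [Fintype P] [DecidableEq P] [Fintype D] [DecidableEq D]

/-- The action of an operator `K` of party `k` alone. -/
def applyAt (k : P) (K : Matrix D D ℂ) (v : (P → D) → ℂ) : (P → D) → ℂ :=
  fun y => ∑ z, K (y k) z * v (Function.update y k z)

lemma prodOp_mulVec_eq_applyAt (k : P) (K : Matrix D D ℂ) (v : (P → D) → ℂ) :
    prodOp (d := fun _ => D) (m := fun _ => D) (fun j => if j = k then K else 1) *ᵥ v =
      applyAt k K v := by
  funext y
  simp only [Matrix.mulVec, dotProduct, prodOp, Matrix.of_apply, applyAt]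
  symm
  refine Finset.sum_of_injOn (Function.update y k) (Function.update_injective y k).injOn
    (fun _ _ => Finset.mem_coe.mpr (Finset.mem_univ _)) ?_ ?_
  · intro x _ hx
    have : ∃ j, j ≠ k ∧ y j ≠ x j := by
      by_contra! h
      refine hx ⟨x k, by simp, ?_⟩
      funext j
      by_cases hj : j = k
      · subst hj; simp
      · rw [Function.update_of_ne hj, h j hj]
    obtain ⟨j, hj, hne⟩ := this
    rw [Finset.prod_eq_zero (Finset.mem_univ j), zero_mul]
    simp [hj, hne]
  · intro z _
    rw [← Finset.mul_prod_erase _ _ (Finset.mem_univ k), Finset.prod_eq_one]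
    · simp
    · intro j hj
      have := Finset.ne_of_mem_erase hj
      rw [if_neg this, Function.update_of_ne this, Matrix.one_apply_eq]

/-- The operators `|y⟩⟨x|` that record `g x = (outcome, y)`, for injective `g`. -/
lemma isKrausFamily_of_injective {Y M : Type} [Fintype Y] [Fintype M] [DecidableEq Y]
    [DecidableEq M] (g : D → Y × M) (hg : Function.Injective g) :
    IsKrausFamily fun y => (Matrix.of fun o x => if g x = (y, o) then (1 : ℂ) else 0) := by
  unfold IsKrausFamily
  ext x x'
  simp only [Matrix.sum_apply, Matrix.mul_apply, Matrix.conjTranspose_apply, Matrix.of_apply,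
    Matrix.one_apply]
  rw [← Fintype.sum_prod_type' (f := fun y o => star (if g x = (y, o) then (1 : ℂ) else 0) *
    if g x' = (y, o) then (1 : ℂ) else 0)]
  rw [Finset.sum_eq_single (g x)]
  · simp [hg.eq_iff, eq_comm]
  · intro b _ hb
    simp [hb.symm]
  · simp

end ApplyAt

/-- Two qubits per party: the one of the segment to the left and the one to the right. -/
abbrev Cell : Type := Fin 2 × Fin 2

/-- The standard maximally entangled vector. -/
def bellKet : Ket2 :=
  schmidtKet (EuclideanSpace.basisFun (Fin 2) ℂ) (EuclideanSpace.basisFun (Fin 2) ℂ) (1 / 2)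

lemma fid_bellKet (χ : Matrix (Fin 2) (Fin 2) ℂ) :
    fid bellKet (rankOne fun w : Fin 2 → Fin 2 => χ (w 0) (w 1)) =
      1 / 2 * ‖χ 0 0 + χ 1 1‖ ^ 2 := by
  have h : star bellKet ⬝ᵥ (fun w : Fin 2 → Fin 2 => χ (w 0) (w 1)) =
      ((√(1 / 2) : ℝ) : ℂ) * (χ 0 0 + χ 1 1) := by
    rw [dotProduct, sum_ket]
    have h12 : (1 - 1 / 2 : ℝ) = 1 / 2 := by norm_num
    simp only [bellKet, schmidtKet, tensorKet, h12, Fin.sum_univ_two, Pi.star_apply, Pi.add_apply,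
      Pi.smul_apply, smul_eq_mul, star_add, star_mul', Matrix.cons_val_zero, Matrix.cons_val_one,
      Complex.star_def, Complex.conj_ofReal]
    simp
    ring
  rw [fid_rankOne, h, norm_mul, mul_pow, Complex.norm_real, Real.norm_eq_abs, sq_abs,
    Real.sq_sqrt (by norm_num)]

/-! ### Protocols on chains with two qubits per party -/

section Attains

variable {n : ℕ}

/-- From the mixture of the pure states `v 0` and `v 1`, some LOCC protocol attains the overlap `t`
with the standard maximally entangled vector. -/
def Attains (v : Fin 2 → (Fin (n + 2) → Cell) → ℂ) (t : ℝ) : Prop :=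
  ∃ Λ : Matrix (∀ _ : Fin (n + 2), Cell) (∀ _ : Fin (n + 2), Cell) ℂ →
      Matrix (∀ k, QubitSys ![0, Fin.last (n + 1)] k) (∀ k, QubitSys ![0, Fin.last (n + 1)] k) ℂ,
    IsLOCC (d := fun _ => Cell) Λ ∧
      ∑ r, endFid 0 (Fin.last (n + 1)) bellKet (Λ (rankOne (v r))) = t

/-- One round in which the other parties do nothing. The vectors stay unnormalised, so outcome
probabilities are built in and the branch values simply add. -/
lemma Attains.measure {v : Fin 2 → (Fin (n + 2) → Cell) → ℂ} (k : Fin (n + 2)) {X : Type}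
    [Fintype X] (K : X → Matrix Cell Cell ℂ) (hK : IsKrausFamily K) (t : X → ℝ)
    (h : ∀ x, Attains (fun r => applyAt k (K x) (v r)) (t x)) : Attains v (∑ x, t x) := by
  choose Λ hΛ ht using h
  refine ⟨_, IsLOCC.round (d := fun _ => Cell) (m := fun _ => Cell) k X
    (fun x j => if j = k then K x else 1) (by simpa using hK) (fun x j hj => by simp [hj]) Λ hΛ, ?_⟩
  simp only [conjBy_rankOne, prodOp_mulVec_eq_applyAt, map_sum]
  rw [Finset.sum_comm]
  exact Finset.sum_congr rfl fun x _ => ht x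

/-- Local embeddings of basis labels are isometries, so the given qubits can be padded to a uniform
two-qubit cell per party at no cost. `hV` and `hV0` say that `V` is the image of `v`: prescribed on
the range, zero off it. -/
lemma Attains.isometry {Q : Type} [Fintype Q] [DecidableEq Q]
    {owner : Q → Fin (n + 2)} {ω : Matrix (Q → Fin 2) (Q → Fin 2) ℂ}
    {v : Fin 2 → (Q → Fin 2) → ℂ} (hω : ω = ∑ r, rankOne (v r))
    (emb : ∀ k, QubitSys owner k → Cell) (hemb : ∀ k, Function.Injective (emb k))
    {V : Fin 2 → (Fin (n + 2) → Cell) → ℂ}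
    (hV : ∀ r x, V r (fun k => emb k (x k)) = v r (gather owner x))
    (hV0 : ∀ r y, (∀ x : ∀ k, QubitSys owner k, (fun k => emb k (x k)) ≠ y) → V r y = 0) {t : ℝ}
    (h : Attains V t) :
    ∃ Λ : Matrix (∀ k, QubitSys owner k) (∀ k, QubitSys owner k) ℂ →
      Matrix (∀ k, QubitSys ![0, Fin.last (n + 1)] k) (∀ k, QubitSys ![0, Fin.last (n + 1)] k) ℂ,
      IsLOCC Λ ∧ ∃ e f : QubitBasis, fid (schmidtKet e f (1 / 2))
        (collect ![0, Fin.last (n + 1)] (Λ (distribute owner ω))) = t := by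
  obtain ⟨Λ, hΛ, ht⟩ := h
  set J : ∀ k, Matrix Cell (QubitSys owner k) ℂ :=
    fun k => Matrix.of fun y x => if y = emb k x then 1 else 0 with hJ
  have hJ1 : ∀ k, (J k)ᴴ * J k = 1 := by
    intro k
    ext x x'
    simp [hJ, Matrix.mul_apply, Matrix.one_apply, (hemb k).eq_iff, eq_comm]
  have hJV : ∀ r, prodOp J *ᵥ (fun x => v r (gather owner x)) = V r := by
    intro r
    funext y
    simp only [Matrix.mulVec, dotProduct, prodOp, Matrix.of_apply, hJ, Fintype.prod_boole]
    by_cases hy : ∃ x : ∀ k, QubitSys owner k, (fun k => emb k (x k)) = y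
    · obtain ⟨x, rfl⟩ := hy
      rw [hV, Finset.sum_eq_single x]
      · simp
      · intro x' _ hx'
        rw [if_neg, zero_mul]
        intro h
        exact hx' (funext fun k => hemb k (h k).symm)
      · simp
    · push Not at hy
      rw [hV0 r y hy]
      refine Finset.sum_eq_zero fun x _ => ?_
      rw [if_neg, zero_mul]
      intro h
      exact hy x (funext fun k => (h k).symm)
  -- A round with a single outcome: an isometry of party 0 is a one-element Kraus family.
  have hR := IsLOCC.round (d := fun k => QubitSys owner k) (m := fun _ => Cell) (0 : Fin (n + 2))
    Unit (fun _ => J) (by simpa [IsKrausFamily] using hJ1 0) (fun _ j _ => hJ1 j) (fun _ => Λ)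
    fun _ => hΛ
  refine ⟨_, hR, EuclideanSpace.basisFun _ _, EuclideanSpace.basisFun _ _, ?_⟩
  have hd : distribute owner ω = ∑ r, rankOne fun x => v r (gather owner x) := by
    rw [hω]
    ext x y
    simp [distribute, Matrix.sum_apply, rankOne, Matrix.vecMulVec_apply]
    rfl
  rw [hd, hR.map_sum]
  simp only [Finset.univ_unique, Finset.sum_singleton, conjBy_rankOne, hJV]
  rw [← ht]
  exact map_sum (endFid 0 (Fin.last (n + 1)) bellKet) _ _

/-- State of a chain in which the segments `s < k` are in the states `ψ s`, the right qubit of party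
`k` and the left qubit of the last party are in the state `W`, and everything else is reset. -/
def tailState (k : Fin (n + 1)) (ψ : Fin (n + 1) → Matrix (Fin 2) (Fin 2) ℂ)
    (W : Matrix (Fin 2) (Fin 2) ℂ) (y : Fin (n + 2) → Cell) : ℂ :=
  if (y 0).1 = 0 ∧ (y (Fin.last (n + 1))).2 = 0 ∧
      ∀ j, k.castSucc < j → j < Fin.last (n + 1) → y j = 0 then
    (∏ s with s < k, ψ s (y s.castSucc).2 (y s.succ).1) *
      W (y k.castSucc).2 (y (Fin.last (n + 1))).1
  else 0

/-- Projection onto `⟨M|` followed by a reset. -/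
def collapse (M : Matrix (Fin 2) (Fin 2) ℂ) : Matrix Cell Cell ℂ :=
  Matrix.of fun c z => if c = 0 then M z.1 z.2 else 0

/-- Action on the right qubit of a party. -/
def onRight (A : Matrix (Fin 2) (Fin 2) ℂ) : Matrix Cell Cell ℂ :=
  Matrix.of fun c z => if c.1 = z.1 then A c.2 z.2 else 0

/-- Action on the left qubit of a party. -/
def onLeft (A : Matrix (Fin 2) (Fin 2) ℂ) : Matrix Cell Cell ℂ :=
  Matrix.of fun c z => if c.2 = z.2 then A c.1 z.1 else 0

lemma isKrausFamily_onRight {X : Type} [Fintype X] {A : X → Matrix (Fin 2) (Fin 2) ℂ}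
    (hA : IsKrausFamily A) : IsKrausFamily fun x => onRight (A x) := by
  unfold IsKrausFamily at *
  ext ⟨a, b⟩ ⟨a', b'⟩
  have h := congrFun (congrFun hA b) b'
  simp only [Matrix.sum_apply, Matrix.mul_apply, Matrix.conjTranspose_apply, onRight,
    Matrix.of_apply, Fintype.sum_prod_type, Matrix.one_apply, Prod.mk.injEq] at h ⊢
  by_cases ha : a = a'
  · subst ha
    simp only [true_and, ← h]
    refine Finset.sum_congr rfl fun x _ => ?_
    rw [Finset.sum_eq_single a] <;> simp +contextual
  · simp only [ha, false_and, if_false]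
    refine Finset.sum_eq_zero fun x _ => Finset.sum_eq_zero fun c _ =>
      Finset.sum_eq_zero fun d _ => ?_
    by_cases hc : c = a
    · subst hc; simp [ha]
    · simp [hc]

lemma isKrausFamily_onLeft {X : Type} [Fintype X] {A : X → Matrix (Fin 2) (Fin 2) ℂ}
    (hA : IsKrausFamily A) : IsKrausFamily fun x => onLeft (A x) := by
  unfold IsKrausFamily at *
  ext ⟨b, a⟩ ⟨b', a'⟩
  have h := congrFun (congrFun hA b) b'
  simp only [Matrix.sum_apply, Matrix.mul_apply, Matrix.conjTranspose_apply, onLeft,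
    Matrix.of_apply, Fintype.sum_prod_type, Matrix.one_apply, Prod.mk.injEq] at h ⊢
  by_cases ha : a = a'
  · subst ha
    simp only [and_true, ← h]
    refine Finset.sum_congr rfl fun x _ => Finset.sum_congr rfl fun c _ => ?_
    rw [Finset.sum_eq_single a] <;> simp +contextual
  · simp only [ha, and_false, if_false]
    refine Finset.sum_eq_zero fun x _ => Finset.sum_eq_zero fun d _ =>
      Finset.sum_eq_zero fun c _ => ?_
    by_cases hc : c = a
    · subst hc; simp [ha]
    · simp [hc]

lemma isKrausFamily_collapse {X : Type} [Fintype X] {M : X → Matrix (Fin 2) (Fin 2) ℂ}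
    (hM : ∀ z z' : Cell, ∑ x, star (M x z.1 z.2) * M x z'.1 z'.2 = if z = z' then 1 else 0) :
    IsKrausFamily fun x => collapse (M x) := by
  unfold IsKrausFamily
  ext z z'
  simp only [Matrix.sum_apply, Matrix.mul_apply, Matrix.conjTranspose_apply, collapse,
    Matrix.of_apply, Matrix.one_apply, ← hM]
  refine Finset.sum_congr rfl fun x _ => ?_
  rw [Finset.sum_eq_single 0] <;> simp +contextual

lemma applyAt_onRight (ψ : Fin (n + 1) → Matrix (Fin 2) (Fin 2) ℂ)
    (A W : Matrix (Fin 2) (Fin 2) ℂ) :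
    applyAt 0 (onRight A) (tailState 0 ψ W) = tailState 0 ψ (A * W) := by
  funext y
  have hl : Fin.last (n + 1) ≠ 0 := by simp [Fin.ext_iff]
  have hc : ∀ z, (∀ j, (0 : Fin (n + 2)) < j → j < Fin.last (n + 1) →
      Function.update y 0 z j = 0) ↔
      ∀ j, (0 : Fin (n + 2)) < j → j < Fin.last (n + 1) → y j = 0 := by
    intro z
    refine forall_congr' fun j => imp_congr_right fun hj => ?_
    rw [Function.update_of_ne hj.ne']
  simp only [applyAt, tailState, hc, Function.update_of_ne hl, Function.update_self,
    Fin.castSucc_zero, onRight, Matrix.of_apply, Fintype.sum_prod_type, Matrix.mul_apply]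
  rw [Finset.sum_eq_single (y 0).1]
  · simp only [Fin.not_lt_zero, Finset.filter_false, Finset.prod_empty, one_mul]
    split_ifs <;> simp
  · intro a _ ha
    simp [ha.symm]
  · simp

/-- Bob's qubit is the column index of the amplitude matrix, hence the transpose. -/
lemma applyAt_onLeft (ψ : Fin (n + 1) → Matrix (Fin 2) (Fin 2) ℂ)
    (B W : Matrix (Fin 2) (Fin 2) ℂ) :
    applyAt (Fin.last (n + 1)) (onLeft B) (tailState 0 ψ W) = tailState 0 ψ (W * Bᵀ) := by
  funext y
  have hl : (0 : Fin (n + 2)) ≠ Fin.last (n + 1) := by simp [Fin.ext_iff]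
  have hc : ∀ z, (∀ j, (0 : Fin (n + 2)) < j → j < Fin.last (n + 1) →
      Function.update y (Fin.last (n + 1)) z j = 0) ↔
      ∀ j, (0 : Fin (n + 2)) < j → j < Fin.last (n + 1) → y j = 0 := by
    intro z
    refine forall_congr' fun j => imp_congr_right fun _ => imp_congr_right fun hj => ?_
    rw [Function.update_of_ne hj.ne]
  simp only [applyAt, tailState, hc, Function.update_of_ne hl, Function.update_self,
    Fin.castSucc_zero, onLeft, Matrix.of_apply, Fintype.sum_prod_type, Matrix.mul_apply,
    Matrix.transpose_apply]
  rw [Finset.sum_comm, Finset.sum_eq_single (y (Fin.last (n + 1))).2]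
  · simp only [Fin.not_lt_zero, Finset.filter_false, Finset.prod_empty, one_mul]
    split_ifs <;> simp [mul_comm]
  · intro a _ ha
    simp [ha.symm]
  · simp

/-- Projecting the two qubits of a node contracts the adjacent amplitude matrices, so entanglement
swapping becomes a matrix product. -/
lemma applyAt_collapse (k : Fin n) (ψ : Fin (n + 1) → Matrix (Fin 2) (Fin 2) ℂ)
    (M W : Matrix (Fin 2) (Fin 2) ℂ) :
    applyAt k.succ.castSucc (collapse M) (tailState k.succ ψ W) =
      tailState k.castSucc ψ (ψ k.castSucc * M * W) := by
  funext y
  have hl : Fin.last (n + 1) ≠ k.succ.castSucc := (Fin.castSucc_lt_last _).ne'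
  have h0 : 0 ≠ k.succ.castSucc := by simp [Fin.ext_iff]
  have hc : ∀ z, (∀ j, k.succ.castSucc < j → j < Fin.last (n + 1) →
      Function.update y k.succ.castSucc z j = 0) ↔
      ∀ j, k.succ.castSucc < j → j < Fin.last (n + 1) → y j = 0 := by
    intro z
    refine forall_congr' fun j => imp_congr_right fun hj => ?_
    rw [Function.update_of_ne hj.ne']
  have hc' : (∀ j, k.castSucc.castSucc < j → j < Fin.last (n + 1) → y j = 0) ↔
      y k.succ.castSucc = 0 ∧ ∀ j, k.succ.castSucc < j → j < Fin.last (n + 1) → y j = 0 := by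
    constructor
    · intro h
      exact ⟨h _ (by simp [Fin.lt_def]) (Fin.castSucc_lt_last _),
        fun j hj => h j (lt_trans (by simp [Fin.lt_def]) hj)⟩
    · rintro ⟨h1, h2⟩ j hj
      rcases (show k.succ.castSucc ≤ j by
        simp only [Fin.lt_def, Fin.le_def, Fin.val_castSucc, Fin.val_succ] at hj ⊢
        omega).eq_or_lt with h | h
      · intro _; rw [← h, h1]
      · exact h2 j h
  have hf : (Finset.univ.filter fun s : Fin (n + 1) => s < k.succ) =
      insert k.castSucc (Finset.univ.filter fun s => s < k.castSucc) := by
    ext s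
    simp only [Finset.mem_filter, Finset.mem_univ, true_and, Finset.mem_insert, Fin.lt_def,
      Fin.ext_iff, Fin.val_castSucc, Fin.val_succ]
    omega
  have hp : ∀ z, ∏ s with s < k.succ, ψ s (Function.update y k.succ.castSucc z s.castSucc).2
      (Function.update y k.succ.castSucc z s.succ).1 =
      ψ k.castSucc (y k.castSucc.castSucc).2 z.1 *
        ∏ s with s < k.castSucc, ψ s (y s.castSucc).2 (y s.succ).1 := by
    intro z
    rw [hf, Finset.prod_insert (by simp)]
    congr 1
    · rw [← Fin.succ_castSucc, Function.update_self, Function.update_of_ne]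
      simp [Fin.ext_iff]
    · refine Finset.prod_congr rfl fun s hs => ?_
      have hs' : (s : ℕ) < k := by simpa [Fin.lt_def] using hs
      rw [Function.update_of_ne, Function.update_of_ne]
      · simp only [ne_eq, Fin.ext_iff, Fin.val_castSucc, Fin.val_succ]; omega
      · simp only [ne_eq, Fin.ext_iff, Fin.val_castSucc, Fin.val_succ]; omega
  simp only [applyAt, tailState, hc, hc', hp, Function.update_of_ne hl, Function.update_of_ne h0,
    Function.update_self, collapse, Matrix.of_apply]
  by_cases hy : y k.succ.castSucc = 0
  · simp only [hy, if_true, true_and]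
    split_ifs
    · rw [Fintype.sum_prod_type, Matrix.mul_apply, Finset.mul_sum, Finset.sum_comm]
      refine Finset.sum_congr rfl fun b _ => ?_
      rw [Matrix.mul_apply, Finset.sum_mul, Finset.mul_sum]
      refine Finset.sum_congr rfl fun a _ => ?_
      ring
    · simp
  · simp only [hy, if_false, zero_mul, Finset.sum_const_zero, false_and, and_false]

/-- For the last index no node has been reset and `W` is the last segment itself: this is the
initial state of the chain. -/
lemma tailState_last (ψ : Fin (n + 1) → Matrix (Fin 2) (Fin 2) ℂ) (y : Fin (n + 2) → Cell) :
    tailState (Fin.last n) ψ (ψ (Fin.last n)) y =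
      if (y 0).1 = 0 ∧ (y (Fin.last (n + 1))).2 = 0 then
        ∏ s, ψ s (y s.castSucc).2 (y s.succ).1 else 0 := by
  have hc : ∀ j, (Fin.last n).castSucc < j → j < Fin.last (n + 1) → y j = 0 := by
    intro j h1 h2
    simp only [Fin.lt_def, Fin.val_castSucc, Fin.val_last] at h1 h2
    omega
  have hf : insert (Fin.last n) (Finset.univ.filter fun s : Fin (n + 1) => s < Fin.last n) =
      Finset.univ := by
    ext s
    simp only [Finset.mem_filter, Finset.mem_univ, true_and, Finset.mem_insert, iff_true]
    exact (Fin.le_last s).eq_or_lt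
  have hc' : (∀ j, (Fin.last n).castSucc < j → j < Fin.last (n + 1) → y j = 0) ↔ True :=
    iff_true_intro hc
  simp only [tailState, hc', and_true]
  conv_rhs => rw [← hf, Finset.prod_insert (by simp), Fin.succ_last]
  simp only [mul_comm, Nat.succ_eq_add_one]

end Attains

/-! ### Discarding all but the end qubits -/

section Discard

variable {n : ℕ}

/-- What a party that keeps only the end-to-end qubits discards. -/
def discarded (k : Fin (n + 2)) (x : Cell) : Cell :=
  if k = 0 then (x.1, 0) else if k = Fin.last (n + 1) then (0, x.2) else x

/-- What a party that keeps only the end-to-end qubits returns. -/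
def kept (k : Fin (n + 2)) (x : Cell) : QubitSys ![0, Fin.last (n + 1)] k :=
  fun q => if q.1 = 0 then x.2 else x.1

/-- Injectivity makes the partial trace a Kraus family, with the discarded label as outcome.
Intermediate nodes return no qubit and discard their whole cell. -/
lemma discarded_kept_injective (k : Fin (n + 2)) :
    Function.Injective fun x => (discarded k x, kept k x) := by
  rintro ⟨a, b⟩ ⟨a', b'⟩ h
  simp only [Prod.mk.injEq] at h
  obtain ⟨h1, h2⟩ := h
  by_cases h0 : k = 0
  · subst h0
    have h3 := congrFun h2 ⟨0, rfl⟩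
    simp [discarded, kept] at h1 h3
    simp [h1, h3]
  · by_cases hl : k = Fin.last (n + 1)
    · subst hl
      have h3 := congrFun h2 ⟨1, rfl⟩
      simp [discarded, kept] at h1 h3
      simp [h1, h3]
    · simpa [discarded, h0, hl] using h1

/-- Basis state with end-to-end qubits `a`, `b`, all other qubits being reset. -/
def endCells (a b : Fin 2) (k : Fin (n + 2)) : Cell :=
  if k = 0 then (0, a) else if k = Fin.last (n + 1) then (b, 0) else 0

lemma endCells_zero (a b : Fin 2) : endCells (n := n) a b 0 = (0, a) := by simp [endCells]

lemma endCells_last (a b : Fin 2) : endCells (n := n) a b (Fin.last (n + 1)) = (b, 0) := by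
  simp [endCells]

lemma tailState_zero (ψ : Fin (n + 1) → Matrix (Fin 2) (Fin 2) ℂ) (χ : Matrix (Fin 2) (Fin 2) ℂ)
    (x : Fin (n + 2) → Cell) :
    tailState 0 ψ χ x = if x = endCells (x 0).2 (x (Fin.last (n + 1))).1 then
      χ (x 0).2 (x (Fin.last (n + 1))).1 else 0 := by
  have h : ((x 0).1 = 0 ∧ (x (Fin.last (n + 1))).2 = 0 ∧
      ∀ j, (0 : Fin (n + 1)).castSucc < j → j < Fin.last (n + 1) → x j = 0) ↔
      x = endCells (x 0).2 (x (Fin.last (n + 1))).1 := by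
    constructor
    · rintro ⟨h0, h1, h2⟩
      funext k
      by_cases hk : k = 0
      · subst hk
        rw [endCells_zero]
        exact Prod.ext h0 rfl
      · by_cases hl : k = Fin.last (n + 1)
        · subst hl
          rw [endCells_last]
          exact Prod.ext rfl h1
        · rw [h2 k (by simpa [Fin.pos_iff_ne_zero] using hk) (Fin.lt_last_iff_ne_last.mpr hl)]
          simp [endCells, hk, hl]
    · intro h
      refine ⟨?_, ?_, fun j h1 h2 => ?_⟩
      · rw [h, endCells_zero]
      · rw [h, endCells_last]
      · rw [h, endCells, if_neg (by simpa using h1.ne'), if_neg h2.ne]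
  simp only [tailState, h]
  simp

/-- Everything except the end qubits is reset, so only the discarded record 0 contributes; the
overlap of `χ` with the Bell vector is |tr χ|²/2. -/
lemma attains_tailState_zero (ψ : Fin 2 → Fin (n + 1) → Matrix (Fin 2) (Fin 2) ℂ)
    (χ : Fin 2 → Matrix (Fin 2) (Fin 2) ℂ) :
    Attains (fun r => tailState 0 (ψ r) (χ r)) (1 / 2 * ∑ r, ‖χ r 0 0 + χ r 1 1‖ ^ 2) := by
  set L : ∀ k : Fin (n + 2), Cell → Matrix (QubitSys ![0, Fin.last (n + 1)] k) Cell ℂ :=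
    fun k y => Matrix.of fun o x => if (discarded k x, kept k x) = (y, o) then 1 else 0 with hL
  refine ⟨_, IsLOCC.localOps (d := fun _ => Cell) (fun _ => Cell) L
    fun k => isKrausFamily_of_injective _ (discarded_kept_injective k), ?_⟩
  have key : ∀ r (y : Fin (n + 2) → Cell), (fun w => (prodOp (d := fun _ => Cell)
      (fun k => L k (y k)) *ᵥ tailState 0 (ψ r) (χ r)) (scatter ![0, Fin.last (n + 1)] w)) =
      if y = 0 then (fun w => χ r (w 0) (w 1)) else (0 : Ket2) := by
    intro r y
    have hdis : ∀ a b (k : Fin (n + 2)), discarded k (endCells a b k) = 0 := by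
      intro a b k
      by_cases h0 : k = 0
      · simp [discarded, endCells, h0]
      · by_cases hl : k = Fin.last (n + 1)
        · simp [discarded, endCells, hl]
        · simp [discarded, endCells, h0, hl]
    funext w
    simp only [Matrix.mulVec, dotProduct, prodOp, Matrix.of_apply, hL, Fintype.prod_boole]
    by_cases hy : y = 0
    · subst hy
      rw [if_pos rfl, Finset.sum_eq_single (endCells (w 0) (w 1))]
      · rw [tailState_zero, endCells_zero, endCells_last, if_pos, one_mul, if_pos rfl]
        intro k
        rw [hdis]
        refine Prod.ext rfl ?_
        funext ⟨q, hq⟩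
        subst hq
        fin_cases q
        · simp [kept, scatter, endCells_zero]
        · simp [kept, scatter, endCells_last]
      · intro x _ hx
        rw [tailState_zero]
        split_ifs with h1 h2
        · exfalso
          have e0 := congrFun (congrArg Prod.snd (h1 0)) ⟨0, rfl⟩
          have e1 := congrFun (congrArg Prod.snd (h1 (Fin.last (n + 1)))) ⟨1, rfl⟩
          simp only [kept, scatter, if_true, Fin.isValue, one_ne_zero, if_false] at e0 e1
          rw [e0, e1] at h2
          exact hx h2
        all_goals simp
      · simp
    · rw [if_neg hy]
      refine Finset.sum_eq_zero fun x _ => ?_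
      rw [tailState_zero]
      split_ifs with h1 h2
      · exfalso
        refine hy (funext fun k => ?_)
        have h3 : discarded k (x k) = y k := congrArg Prod.fst (h1 k)
        rw [← h3, h2]
        exact hdis _ _ k
      all_goals simp
  simp only [conjBy_rankOne, map_sum, endFid_rankOne, key]
  rw [Finset.mul_sum]
  refine Finset.sum_congr rfl fun r _ => ?_
  rw [Finset.sum_eq_single 0, if_pos rfl, fid_bellKet]
  · intro y _ hy
    rw [if_neg hy, fid_rankOne]
    simp
  · simp

end Discard

/-! ### Alice's filter and Bob's correction -/

section Filter

variable {n : ℕ}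

/-- Amplitudes of the vectors mixed in the noisy state, in the bases that define it. -/
def noisyMat (p δ : ℝ) : Fin 2 → Matrix (Fin 2) (Fin 2) ℂ :=
  ![!![((√p : ℝ) : ℂ), 0; 0, 0],
    !![0, ((√(1 - p) * √δ : ℝ) : ℂ); ((√(1 - p) * √(1 - δ) : ℝ) : ℂ), 0]]

lemma ketMat_noisyKet (u v : QubitBasis) (p δ : ℝ) (r : Fin 2) :
    ketMat (noisyKet u v p δ r) = basisMat u * noisyMat p δ r * (basisMat v)ᵀ := by
  ext a b
  fin_cases r <;>
    simp [ketMat, noisyKet, noisyMat, tensorKet, basisMat, Matrix.mul_apply, Fin.sum_univ_two] <;>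
    ring

/-- Contribution to the optimal value of an outcome for which Bob's vectors have the squared norms
`S` and `T`. -/
def outcomeValue (p δ S T : ℝ) : ℝ :=
  1 / 2 * ((p + (1 - p) * (1 - δ)) * S + (1 - p) * δ * T + (1 - p) ^ 2 * (δ * (1 - δ)) / p * T)

lemma norm_ofReal_sq (x : ℝ) : ‖(x : ℂ)‖ ^ 2 = x ^ 2 := by
  rw [Complex.norm_real, Real.norm_eq_abs, sq_abs]

/-- Alice's filter attains the optimum from an unbalanced noisy state. -/
lemma attains_filter {p δ : ℝ} (hp : p ∈ Set.Ioo 0 1) (hδ : δ ∈ Set.Ico (1 / 2) 1)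
    (ψ : Fin 2 → Fin (n + 1) → Matrix (Fin 2) (Fin 2) ℂ) {U N : Matrix (Fin 2) (Fin 2) ℂ}
    (hU : Uᴴ * U = 1) {S T : ℝ} (hS : 0 < S) (hT : 0 < T)
    (hN : N * Nᴴ = !![(S : ℂ), 0; 0, (T : ℂ)])
    (hST : (1 - p) ^ 2 * (δ * (1 - δ)) * T ≤ p ^ 2 * S) :
    Attains (fun r => tailState 0 (ψ r) (U * noisyMat p δ r * N)) (outcomeValue p δ S T) := by
  have hp0 : 0 < p := hp.1
  have hp1 : 0 < 1 - p := by linarith [hp.2]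
  have hd0 : 0 < δ := by linarith [hδ.1]
  have hd1 : 0 < 1 - δ := by linarith [hδ.2]
  obtain ⟨s, hs, rfl⟩ : ∃ s : ℝ, 0 < s ∧ s ^ 2 = S := ⟨√S, Real.sqrt_pos.mpr hS, Real.sq_sqrt hS.le⟩
  obtain ⟨t, ht, rfl⟩ : ∃ t : ℝ, 0 < t ∧ t ^ 2 = T := ⟨√T, Real.sqrt_pos.mpr hT, Real.sq_sqrt hT.le⟩
  have hsC : (s : ℂ) ≠ 0 := by exact_mod_cast hs.ne'
  have htC : (t : ℂ) ≠ 0 := by exact_mod_cast ht.ne'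
  -- Twice the total value depends on x through 2x(1-p)√(δ(1-δ))st - x²ps², and this x is the
  -- maximiser. The hypothesis `hST` is the condition x² ≤ 1 for a valid filter.
  set x : ℝ := (1 - p) * (√δ * √(1 - δ)) * t / (p * s) with hx
  have hx0 : 0 ≤ x := by positivity
  have hx2 : x ^ 2 * (p ^ 2 * s ^ 2) = (1 - p) ^ 2 * (δ * (1 - δ)) * t ^ 2 := by
    rw [hx, div_pow, mul_pow, mul_pow, mul_pow, Real.sq_sqrt hd0.le, Real.sq_sqrt hd1.le]
    field_simp
  have hx1 : x ^ 2 ≤ 1 := by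
    by_contra! h
    have : 0 < p ^ 2 * s ^ 2 := by positivity
    nlinarith
  have hy : 0 ≤ 1 - x ^ 2 := by linarith
  set y : ℝ := √(1 - x ^ 2) with hydef
  have hy2 : y ^ 2 = 1 - x ^ 2 := Real.sq_sqrt hy
  have hyC : (y : ℂ) * y = 1 - (x : ℂ) * x := by
    rw [← sq, ← sq]; exact_mod_cast hy2
  have hUU : U * Uᴴ = 1 := mul_eq_one_comm.mp hU
  -- Bob's unitary
  set C : Matrix (Fin 2) (Fin 2) ℂ := Nᴴ * !![0, (s : ℂ)⁻¹; (t : ℂ)⁻¹, 0] with hC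
  -- `N` is diag(s, t) times a unitary; `C` undoes that unitary and flips Bob's bit, which makes the
  -- ζ-branch diagonal.
  have hNC : N * C = !![0, (s : ℂ); (t : ℂ), 0] := by
    rw [hC, ← Matrix.mul_assoc, hN]
    ext i j
    fin_cases i <;> fin_cases j <;> simp [Matrix.mul_apply, Fin.sum_univ_two] <;> field_simp
  have hCC : Cᴴ * C = 1 := by
    have : Cᴴ * C = (!![0, (s : ℂ)⁻¹; (t : ℂ)⁻¹, 0])ᴴ * (N * C) := by
      rw [hC, Matrix.conjTranspose_mul, Matrix.conjTranspose_conjTranspose, Matrix.mul_assoc]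
    rw [this, hNC]
    ext i j
    fin_cases i <;> fin_cases j <;>
      simp [Matrix.mul_apply, Fin.sum_univ_two, Matrix.conjTranspose_apply, hsC, htC]
  have hCC' : C * Cᴴ = 1 := mul_eq_one_comm.mp hCC
  have hB : (Cᵀ)ᴴ * Cᵀ = 1 := by
    have h := congrArg Matrix.transpose hCC'
    rw [Matrix.transpose_mul, Matrix.transpose_one] at h
    exact h
  -- Alice's filter
  set A : Fin 2 → Matrix (Fin 2) (Fin 2) ℂ :=
    ![!![(x : ℂ), 0; 0, 1] * Uᴴ, !![(y : ℂ), 0; 0, 0] * Uᴴ] with hA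
  have hAK : IsKrausFamily A := by
    have h1 : (!![(x : ℂ), 0; 0, 1])ᴴ * !![(x : ℂ), 0; 0, 1] +
        (!![(y : ℂ), 0; 0, 0])ᴴ * !![(y : ℂ), 0; 0, 0] = 1 := by
      ext i j
      fin_cases i <;> fin_cases j <;>
        simp [Matrix.mul_apply, Fin.sum_univ_two, Matrix.conjTranspose_apply, hyC]
    have h2 : ∀ D : Matrix (Fin 2) (Fin 2) ℂ, (D * Uᴴ)ᴴ * (D * Uᴴ) = U * (Dᴴ * D) * Uᴴ := by
      intro D
      simp only [Matrix.conjTranspose_mul, Matrix.conjTranspose_conjTranspose, Matrix.mul_assoc]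
    rw [IsKrausFamily, Fin.sum_univ_two]
    simp only [hA, Matrix.cons_val_zero, Matrix.cons_val_one]
    rw [h2, h2, ← Matrix.add_mul, ← Matrix.mul_add, h1, Matrix.mul_one, hUU]
  have hreset : IsKrausFamily fun j : Fin 2 => (Matrix.single 0 j 1 : Matrix (Fin 2) (Fin 2) ℂ) := by
    rw [IsKrausFamily, Fin.sum_univ_two]
    ext i j
    fin_cases i <;> fin_cases j <;>
      simp
  have hW : ∀ (D : Matrix (Fin 2) (Fin 2) ℂ) r, D * Uᴴ * (U * noisyMat p δ r * N * Cᵀᵀ) =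
      D * (noisyMat p δ r * !![0, (s : ℂ); (t : ℂ), 0]) := by
    intro D r
    rw [Matrix.transpose_transpose, Matrix.mul_assoc _ N, hNC, Matrix.mul_assoc U,
      Matrix.mul_assoc D, ← Matrix.mul_assoc Uᴴ, hU, Matrix.one_mul]
  -- On success the |ψφ⟩ branch is off-diagonal and has trace zero; only the filtered ζ-branch
  -- overlaps the Bell vector.
  have hsucc : Attains (fun r => tailState 0 (ψ r) (A 0 * (U * noisyMat p δ r * N * Cᵀᵀ)))
      (1 / 2 * ((1 - p) * (x * √δ * t + √(1 - δ) * s) ^ 2)) := by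
    convert attains_tailState_zero ψ fun r => A 0 * (U * noisyMat p δ r * N * Cᵀᵀ) using 2
    simp only [hA, Matrix.cons_val_zero, hW]
    have e0 : (!![(x : ℂ), 0; 0, 1] * (noisyMat p δ 0 * !![0, (s : ℂ); (t : ℂ), 0])) 0 0 +
        (!![(x : ℂ), 0; 0, 1] * (noisyMat p δ 0 * !![0, (s : ℂ); (t : ℂ), 0])) 1 1 = 0 := by
      simp [noisyMat, Matrix.mul_apply, Fin.sum_univ_two]
    have e1 : (!![(x : ℂ), 0; 0, 1] * (noisyMat p δ 1 * !![0, (s : ℂ); (t : ℂ), 0])) 0 0 +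
        (!![(x : ℂ), 0; 0, 1] * (noisyMat p δ 1 * !![0, (s : ℂ); (t : ℂ), 0])) 1 1 =
        ((√(1 - p) * (x * √δ * t + √(1 - δ) * s) : ℝ) : ℂ) := by
      simp [noisyMat, Matrix.mul_apply, Fin.sum_univ_two]
      ring
    rw [Fin.sum_univ_two, e0, e1, norm_ofReal_sq, mul_pow, Real.sq_sqrt hp1.le]
    simp
  -- On failure Alice's qubit is in |0⟩. Bob resets his to |0⟩ as well, and |00⟩ yields half the
  -- weight of the branch.
  have hfail : Attains (fun r => tailState 0 (ψ r) (A 1 * (U * noisyMat p δ r * N * Cᵀᵀ)))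
      (1 / 2 * ((1 - x ^ 2) * (p * s ^ 2 + (1 - p) * δ * t ^ 2))) := by
    have h := Attains.measure (v := fun r => tailState 0 (ψ r)
        (A 1 * (U * noisyMat p δ r * N * Cᵀᵀ))) (Fin.last (n + 1)) _ (isKrausFamily_onLeft hreset)
      (fun j => 1 / 2 * ∑ r, ‖(A 1 * (U * noisyMat p δ r * N * Cᵀᵀ) *
        (Matrix.single 0 j 1 : Matrix (Fin 2) (Fin 2) ℂ)ᵀ) 0 0 +
        (A 1 * (U * noisyMat p δ r * N * Cᵀᵀ) *
        (Matrix.single 0 j 1 : Matrix (Fin 2) (Fin 2) ℂ)ᵀ) 1 1‖ ^ 2) ?_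
    · convert h using 1
      have hAW : ∀ r, A 1 * (U * noisyMat p δ r * N * Cᵀᵀ) =
          !![(y : ℂ), 0; 0, 0] * (noisyMat p δ r * !![0, (s : ℂ); (t : ℂ), 0]) := hW _
      simp only [hAW]
      have e : ∀ j r, (!![(y : ℂ), 0; 0, 0] * (noisyMat p δ r * !![0, (s : ℂ); (t : ℂ), 0]) *
          (Matrix.single 0 j 1 : Matrix (Fin 2) (Fin 2) ℂ)ᵀ) 0 0 +
          (!![(y : ℂ), 0; 0, 0] * (noisyMat p δ r * !![0, (s : ℂ); (t : ℂ), 0]) *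
          (Matrix.single 0 j 1 : Matrix (Fin 2) (Fin 2) ℂ)ᵀ) 1 1 =
          ((![![0, y * (√(1 - p) * √δ * t)], ![y * (√p * s), 0]] j r : ℝ) : ℂ) := by
        intro j r
        fin_cases j <;> fin_cases r <;>
          simp [noisyMat, Matrix.mul_apply, Matrix.single_apply]
      simp only [e, norm_ofReal_sq, Fin.sum_univ_two, Matrix.cons_val_zero, Matrix.cons_val_one,
        mul_pow, Real.sq_sqrt hp1.le, Real.sq_sqrt hd0.le, Real.sq_sqrt hp0.le, hy2]
      ring
    · intro j
      simp only [applyAt_onLeft]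
      exact attains_tailState_zero ψ _
  have hmid : Attains (fun r => tailState 0 (ψ r) (U * noisyMat p δ r * N * Cᵀᵀ))
      (outcomeValue p δ (s ^ 2) (t ^ 2)) := by
    have h := Attains.measure (v := fun r => tailState 0 (ψ r)
        (U * noisyMat p δ r * N * Cᵀᵀ)) 0 _ (isKrausFamily_onRight hAK)
      ![1 / 2 * ((1 - p) * (x * √δ * t + √(1 - δ) * s) ^ 2),
        1 / 2 * ((1 - x ^ 2) * (p * s ^ 2 + (1 - p) * δ * t ^ 2))] ?_
    · convert h using 1
      have h1 : √δ ^ 2 = δ := Real.sq_sqrt hd0.le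
      have h2 : √(1 - δ) ^ 2 = 1 - δ := Real.sq_sqrt hd1.le
      have h3 : x * (p * s) = (1 - p) * (√δ * √(1 - δ)) * t := by
        rw [hx]
        field_simp
      have h4 : (1 - p) ^ 2 * (δ * (1 - δ)) / p * t ^ 2 = x ^ 2 * p * s ^ 2 := by
        field_simp
        linarith
      simp only [Fin.sum_univ_two, Matrix.cons_val_zero, Matrix.cons_val_one, outcomeValue]
      rw [h4]
      clear_value x
      linear_combination (x * s) * h3 + (-1 / 2 * (1 - p) * x ^ 2 * t ^ 2) * h1 -
        1 / 2 * (1 - p) * s ^ 2 * h2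
    · intro j
      simp only [applyAt_onRight]
      fin_cases j
      · exact hsucc
      · exact hfail
  have h := Attains.measure (v := fun r => tailState 0 (ψ r) (U * noisyMat p δ r * N))
    (X := Unit) (Fin.last (n + 1)) _ (isKrausFamily_onLeft (A := fun _ => Cᵀ)
      (by simpa [IsKrausFamily] using hB)) (fun _ => outcomeValue p δ (s ^ 2) (t ^ 2)) ?_
  · simpa using h
  · intro _
    simp only [applyAt_onLeft]
    exact hmid

end Filter

/-! ### Bell measurements in rotated bases -/

open scoped Kronecker

/-- The Pauli matrices (up to phases). -/
def pauli (x : Cell) : Matrix (Fin 2) (Fin 2) ℂ :=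
  ![![!![1, 0; 0, 1], !![1, 0; 0, -1]], ![!![0, 1; 1, 0], !![0, 1; -1, 0]]] x.1 x.2

lemma pauli_unitary (x : Cell) : (pauli x)ᴴ * pauli x = 1 := by
  obtain ⟨m, k⟩ := x
  ext i j
  fin_cases m <;> fin_cases k <;> fin_cases i <;> fin_cases j <;>
    simp [pauli, Matrix.mul_apply, Matrix.conjTranspose_apply]

lemma sum_pauli (z z' : Cell) :
    ∑ x, star (pauli x z.1 z.2) * pauli x z'.1 z'.2 = if z = z' then 2 else 0 := by
  obtain ⟨a, b⟩ := z
  obtain ⟨c, d⟩ := z'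
  rw [Fintype.sum_prod_type]
  fin_cases a <;> fin_cases b <;> fin_cases c <;> fin_cases d <;>
    simp [pauli, Fin.sum_univ_two] <;> norm_num

/-- The Bell measurement between locally rotated bases. -/
def bellOp (S T : Matrix (Fin 2) (Fin 2) ℂ) (x : Cell) : Matrix (Fin 2) (Fin 2) ℂ :=
  ((√(1 / 2) : ℝ) : ℂ) • (S * pauli x * T)

lemma sqrt_half_mul : ((√(1 / 2) : ℝ) : ℂ) * ((√(1 / 2) : ℝ) : ℂ) = 1 / 2 := by
  rw [← Complex.ofReal_mul, Real.mul_self_sqrt (by norm_num)]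
  norm_num

/-- Listed by outcome, the coefficients form the Bell matrix times the Kronecker product of `Sᵀ` and
`T`; both factors are unitary. -/
lemma isKrausFamily_bellOp {S T : Matrix (Fin 2) (Fin 2) ℂ} (hS : Sᴴ * S = 1) (hT : Tᴴ * T = 1) :
    IsKrausFamily fun x => collapse (bellOp S T x) := by
  refine isKrausFamily_collapse fun z z' => ?_
  set B : Matrix Cell Cell ℂ := Matrix.of fun x z => ((√(1 / 2) : ℝ) : ℂ) * pauli x z.1 z.2 with hB
  set G : Matrix Cell Cell ℂ := Sᵀ ⊗ₖ T with hG
  have hBB : Bᴴ * B = 1 := by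
    ext z z'
    have h := sum_pauli z z'
    simp only [Matrix.mul_apply, Matrix.conjTranspose_apply, hB, Matrix.of_apply, star_mul',
      Matrix.one_apply, Complex.star_def, Complex.conj_ofReal] at h ⊢
    calc _ = ((√(1 / 2) : ℝ) : ℂ) * ((√(1 / 2) : ℝ) : ℂ) *
          ∑ x, (starRingEnd ℂ) (pauli x z.1 z.2) * pauli x z'.1 z'.2 := by
          rw [Finset.mul_sum]
          exact Finset.sum_congr rfl fun x _ => by ring
      _ = _ := by
          rw [h, sqrt_half_mul]
          split_ifs <;> norm_num
  have hSS : (Sᵀ)ᴴ * Sᵀ = 1 := by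
    have h := congrArg Matrix.transpose (mul_eq_one_comm.mp hS)
    rw [Matrix.transpose_mul, Matrix.transpose_one] at h
    exact h
  have hGG : Gᴴ * G = 1 := by
    rw [hG, Matrix.conjTranspose_kronecker, ← Matrix.mul_kronecker_mul, hSS, hT,
      Matrix.one_kronecker_one]
  have hBG : ∀ x z, (B * G) x z = bellOp S T x z.1 z.2 := by
    intro x z
    simp only [Matrix.mul_apply, bellOp, hB, hG, Matrix.of_apply, Matrix.kroneckerMap_apply,
      Matrix.transpose_apply, Matrix.smul_apply, smul_eq_mul, Fintype.sum_prod_type,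
      Fin.sum_univ_two]
    ring
  have h : ((B * G)ᴴ * (B * G)) z z' = if z = z' then 1 else 0 := by
    rw [Matrix.conjTranspose_mul, Matrix.mul_assoc, ← Matrix.mul_assoc Bᴴ, hBB, Matrix.one_mul,
      hGG, Matrix.one_apply]
  rw [← h, Matrix.mul_apply]
  exact Finset.sum_congr rfl fun x _ => by rw [Matrix.conjTranspose_apply, hBG, hBG]

lemma norm_det_unitary {U : Matrix (Fin 2) (Fin 2) ℂ} (hU : Uᴴ * U = 1) : ‖U.det‖ = 1 := by
  have h := congrArg Matrix.det hU
  rw [Matrix.det_mul, Matrix.det_conjTranspose, Matrix.det_one, Complex.star_def,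
    Complex.conj_mul'] at h
  have h2 : ‖U.det‖ ^ 2 = 1 := by exact_mod_cast h
  nlinarith [norm_nonneg U.det, sq_nonneg (‖U.det‖ - 1)]

lemma unitary_mul {U V : Matrix (Fin 2) (Fin 2) ℂ} (hU : Uᴴ * U = 1) (hV : Vᴴ * V = 1) :
    (U * V)ᴴ * (U * V) = 1 := by
  rw [Matrix.conjTranspose_mul, Matrix.mul_assoc, ← Matrix.mul_assoc Uᴴ, hU, Matrix.one_mul, hV]

/-- The modulus is the same for every outcome, so multiplicativity of the determinant makes
concurrences multiply under equally likely swaps. -/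
lemma norm_det_bellOp {S T : Matrix (Fin 2) (Fin 2) ℂ} (hS : Sᴴ * S = 1) (hT : Tᴴ * T = 1)
    (x : Cell) : ‖(bellOp S T x).det‖ = 1 / 2 := by
  rw [bellOp, Matrix.det_smul, Fintype.card_fin, sq, sqrt_half_mul, norm_mul,
    norm_det_unitary (unitary_mul (unitary_mul hS (pauli_unitary x)) hT)]
  norm_num

/-- Local diagonalisation: `T (W Wᴴ) Tᴴ` is diagonal for some unitary `T`. -/
lemma exists_diagonal (W : Matrix (Fin 2) (Fin 2) ℂ) :
    ∃ (T : Matrix (Fin 2) (Fin 2) ℂ) (l m : ℝ), Tᴴ * T = 1 ∧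
      T * (W * Wᴴ) * Tᴴ = !![(l : ℂ), 0; 0, (m : ℂ)] := by
  have hA : (W * Wᴴ).IsHermitian := Matrix.isHermitian_mul_conjTranspose_self W
  have h := hA.conjStarAlgAut_star_eigenvectorUnitary
  rw [Unitary.conjStarAlgAut_apply] at h
  refine ⟨(star hA.eigenvectorUnitary : Matrix.unitaryGroup (Fin 2) ℂ), hA.eigenvalues 0,
    hA.eigenvalues 1, ?_, ?_⟩
  · rw [← Matrix.star_eq_conjTranspose]
    exact Unitary.star_mul_self_of_mem (star hA.eigenvectorUnitary).2
  · refine h.trans ?_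
    ext i j
    fin_cases i <;> fin_cases j <;> simp

/-- The Hadamard matrix. -/
def hadamard : Matrix (Fin 2) (Fin 2) ℂ := ((√(1 / 2) : ℝ) : ℂ) • !![1, 1; 1, -1]

lemma hadamard_unitary : hadamardᴴ * hadamard = 1 := by
  have h := sqrt_half_mul
  ext i j
  fin_cases i <;> fin_cases j <;>
    simp only [hadamard, Matrix.mul_apply, Matrix.conjTranspose_apply, Fin.sum_univ_two,
      Matrix.smul_apply, smul_eq_mul, star_mul', Complex.star_def, Complex.conj_ofReal,
      Matrix.of_apply, Matrix.cons_val', Matrix.cons_val_zero, Matrix.cons_val_one,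
      Matrix.cons_val_fin_one, map_one, map_neg, Fin.zero_eta, Fin.mk_one, Matrix.one_apply,
      Fin.isValue, if_true, zero_ne_one, one_ne_zero, if_false] <;>
    first | linear_combination (2 : ℂ) * h | ring

/-! ### Entanglement swapping along the chain -/

section Swap

variable {n : ℕ}

lemma bellOp_mul_left (R S T : Matrix (Fin 2) (Fin 2) ℂ) (x : Cell) :
    R * bellOp S T x = bellOp (R * S) T x := by
  simp only [bellOp, Matrix.mul_smul, Matrix.mul_assoc]

/-- Conjugation of a diagonal matrix by a Pauli matrix permutes the diagonal. -/
lemma pauli_conj_diagonal (x : Cell) (l m : ℂ) :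
    pauli x * !![l, 0; 0, m] * (pauli x)ᴴ =
      if x.1 = 0 then !![l, 0; 0, m] else !![m, 0; 0, l] := by
  obtain ⟨a, b⟩ := x
  ext i j
  fin_cases a <;> fin_cases b <;> fin_cases i <;> fin_cases j <;>
    simp [pauli, Matrix.mul_apply, Fin.sum_univ_two, Matrix.conjTranspose_apply]

lemma mul_bellOp_mul_conjTranspose (R T W : Matrix (Fin 2) (Fin 2) ℂ) (x : Cell) :
    (bellOp R T x * W) * (bellOp R T x * W)ᴴ =
      (1 / 2 : ℂ) • (R * (pauli x * (T * (W * Wᴴ) * Tᴴ) * (pauli x)ᴴ) * Rᴴ) := by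
  rw [bellOp, Matrix.smul_mul, Matrix.conjTranspose_smul, Matrix.smul_mul, Matrix.mul_smul,
    smul_smul, Complex.star_def, Complex.conj_ofReal, sqrt_half_mul]
  simp only [Matrix.conjTranspose_mul, Matrix.mul_assoc]

/-- Swapping two pure states in unbiased bases: all outcomes are equally likely. -/
lemma exists_unbiased_swap (φ W : Matrix (Fin 2) (Fin 2) ℂ) :
    ∃ S T : Matrix (Fin 2) (Fin 2) ℂ, Sᴴ * S = 1 ∧ Tᴴ * T = 1 ∧
      ∀ x, ((φ * bellOp S T x * W) * (φ * bellOp S T x * W)ᴴ).trace =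
        1 / 4 * (φ * φᴴ).trace * (W * Wᴴ).trace := by
  obtain ⟨T, l, m, hT, hTW⟩ := exists_diagonal W
  obtain ⟨R, l', m', hR, hRφ⟩ := exists_diagonal φᴴ
  rw [Matrix.conjTranspose_conjTranspose] at hRφ
  have hRR : R * Rᴴ = 1 := mul_eq_one_comm.mp hR
  have htr : ∀ V A : Matrix (Fin 2) (Fin 2) ℂ, Vᴴ * V = 1 → (V * A * Vᴴ).trace = A.trace := by
    intro V A hV
    rw [Matrix.trace_mul_comm, ← Matrix.mul_assoc, hV, Matrix.one_mul]
  have h1 : (W * Wᴴ).trace = l + m := by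
    rw [← htr T _ hT, hTW]
    simp [Matrix.trace, Fin.sum_univ_two]
  have h2 : (φ * φᴴ).trace = l' + m' := by
    rw [Matrix.trace_mul_comm, ← htr R _ hR, hRφ]
    simp [Matrix.trace, Fin.sum_univ_two]
  -- The Hadamard matrix makes the two Schmidt bases mutually unbiased: conjugating a diagonal
  -- matrix by it levels the diagonal, so the Pauli permutation of the entries does not affect the
  -- trace.
  refine ⟨Rᴴ * hadamard, T, unitary_mul (by simpa using hRR) hadamard_unitary, hT, fun x => ?_⟩
  rw [bellOp_mul_left, mul_bellOp_mul_conjTranspose, hTW, pauli_conj_diagonal, h1, h2,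
    Matrix.trace_smul]
  have h3 : ∀ D : Matrix (Fin 2) (Fin 2) ℂ,
      ((φ * (Rᴴ * hadamard)) * D * (φ * (Rᴴ * hadamard))ᴴ).trace =
        (hadamard * D * hadamardᴴ * !![(l' : ℂ), 0; 0, (m' : ℂ)]).trace := by
    intro D
    rw [← hRφ, Matrix.conjTranspose_mul, Matrix.conjTranspose_mul,
      Matrix.conjTranspose_conjTranspose]
    have e1 : φ * (Rᴴ * hadamard) * D * (hadamardᴴ * R * φᴴ) =
        (φ * Rᴴ) * (hadamard * D * hadamardᴴ * (R * φᴴ)) := by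
      simp only [Matrix.mul_assoc]
    rw [e1, Matrix.trace_mul_comm]
    simp only [Matrix.mul_assoc]
  have h4 : ∀ a b : ℂ, (hadamard * !![a, 0; 0, b] * hadamardᴴ *
      !![(l' : ℂ), 0; 0, (m' : ℂ)]).trace = 1 / 2 * (a + b) * (l' + m') := by
    intro a b
    have h := sqrt_half_mul
    simp only [Matrix.trace, Matrix.diag, hadamard, Matrix.mul_apply, Fin.sum_univ_two,
      Matrix.conjTranspose_apply, Matrix.smul_apply, smul_eq_mul, star_mul', Complex.star_def,
      Complex.conj_ofReal, Matrix.of_apply, Matrix.cons_val', Matrix.cons_val_zero,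
      Matrix.cons_val_one, Matrix.cons_val_fin_one, map_one, map_neg, Fin.isValue]
    linear_combination (a + b) * (l' + m' : ℂ) * h
  rw [h3]
  split_ifs
  · rw [h4, smul_eq_mul]; ring
  · rw [h4, smul_eq_mul]; ring

/-- The states at the two ends of the noisy segment, as matrices. -/
def noisySegment (u v : QubitBasis) (p δ : ℝ) (r : Fin 2) : Matrix (Fin 2) (Fin 2) ℂ :=
  basisMat u * noisyMat p δ r * (basisMat v)ᵀ

lemma basisMat_transpose_mul (v : QubitBasis) : (basisMat v)ᵀ * ((basisMat v)ᵀ)ᴴ = 1 := by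
  have h := congrArg Matrix.transpose (basisMat_conjTranspose_mul v)
  rw [Matrix.transpose_mul, Matrix.transpose_one] at h
  exact h

/-- The condition that the squared concurrence `c` of a pure state shared with Bob is large
enough. -/
def Sufficient (p δ c : ℝ) : Prop :=
  p ∈ Set.Ioo 0 1 ∧ δ ∈ Set.Ico (1 / 2) 1 ∧ 0 < c ∧
    (1 + √(1 - c)) / 2 ≤ p ^ 2 / (p ^ 2 + δ * (1 - δ) * (1 - p) ^ 2)

/-- The weights l and m are w(1 ± √(1-c))/2. The inequality in `Sufficient` bounds the larger one by
wp²/(p² + δ(1-δ)(1-p)²), so it serves for m in either order; substituting w = l + m gives the filter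
condition. -/
lemma Sufficient.balanced {p δ c : ℝ} (h : Sufficient p δ c) {l m w : ℝ} (hw : 0 < w)
    (hlm : l + m = w) (hdet : 4 * (l * m) = w ^ 2 * c) :
    0 < l ∧ 0 < m ∧ (1 - p) ^ 2 * (δ * (1 - δ)) * m ≤ p ^ 2 * l := by
  obtain ⟨hp, hδ, hc, hle⟩ := h
  have hprod : 0 < l * m := by
    have : 0 < w ^ 2 * c := by positivity
    linarith
  have hl : 0 < l := by
    by_contra! hl
    have hm : m < 0 := by
      by_contra! hm
      exact absurd hprod (not_lt.mpr (mul_nonpos_of_nonpos_of_nonneg hl hm))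
    linarith
  have hm : 0 < m := pos_of_mul_pos_right hprod hl.le
  refine ⟨hl, hm, ?_⟩
  have h2 : 0 ≤ δ * (1 - δ) := mul_nonneg (by linarith [hδ.1]) (by linarith [hδ.2])
  have hd : 0 < p ^ 2 + δ * (1 - δ) * (1 - p) ^ 2 := by
    have := pow_pos hp.1 2
    positivity
  rw [le_div_iff₀ hd] at hle
  have hsq : m - l ≤ w * √(1 - c) := by
    have h1 : (m - l) ^ 2 = w ^ 2 * (1 - c) := by rw [← hlm] at hdet ⊢; linarith
    have h3 : |m - l| = w * √(1 - c) := by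
      rw [← Real.sqrt_sq_eq_abs, h1, Real.sqrt_mul (sq_nonneg w), Real.sqrt_sq hw.le]
    rw [← h3]
    exact le_abs_self _
  have hm2 : m ≤ w * ((1 + √(1 - c)) / 2) := by linarith
  have h4 : m * (p ^ 2 + δ * (1 - δ) * (1 - p) ^ 2) ≤ w * p ^ 2 := by
    calc _ ≤ w * ((1 + √(1 - c)) / 2) * (p ^ 2 + δ * (1 - δ) * (1 - p) ^ 2) := by gcongr
      _ = w * ((1 + √(1 - c)) / 2 * (p ^ 2 + δ * (1 - δ) * (1 - p) ^ 2)) := by ring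
      _ ≤ _ := by gcongr
  rw [← hlm] at h4
  linarith

lemma optValue_eq_outcomeValue (p δ w : ℝ) : w * optValue p δ = outcomeValue p δ w w := by
  simp only [optValue, outcomeValue]
  ring

/-- The last swap: Bob is connected to the first node by one pure state. -/
lemma attains_last_swap {p δ c : ℝ} (hc : Sufficient p δ c) (u v : QubitBasis)
    (ψ : Fin 2 → Fin (n + 2) → Matrix (Fin 2) (Fin 2) ℂ)
    (hψ : ∀ r, ψ r 0 = noisySegment u v p δ r) {W : Matrix (Fin 2) (Fin 2) ℂ} {w : ℝ} (hw : 0 < w)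
    (htr : (W * Wᴴ).trace = w) (hdet : 4 * ‖W.det‖ ^ 2 = w ^ 2 * c) :
    Attains (fun r => tailState (Fin.succ 0) (ψ r) W) (w * optValue p δ) := by
  obtain ⟨T, l, m, hT, hTW⟩ := exists_diagonal W
  have hlm : l + m = w := by
    have h := congrArg Matrix.trace hTW
    rw [Matrix.trace_mul_comm, ← Matrix.mul_assoc, hT, Matrix.one_mul, htr] at h
    simp only [Matrix.trace, Matrix.diag, Fin.sum_univ_two] at h
    simp at h
    exact_mod_cast h.symm
  have hlm2 : l * m = ‖W.det‖ ^ 2 := by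
    have h := congrArg Matrix.det hTW
    have h1 := congrArg Matrix.det hT
    rw [Matrix.det_mul, Matrix.det_one] at h1
    rw [Matrix.det_mul, Matrix.det_mul, Matrix.det_mul, mul_right_comm, mul_comm T.det, h1, one_mul,
      Matrix.det_conjTranspose, Complex.star_def, Complex.mul_conj', Matrix.det_fin_two_of] at h
    simp only [mul_zero, sub_zero] at h
    exact_mod_cast h.symm
  obtain ⟨hl, hm, h1⟩ := hc.balanced hw hlm (by rw [hlm2, hdet])
  -- Outcomes with a bit flip exchange l and m, so the filter condition is needed in both orders.
  obtain ⟨-, -, h2⟩ := hc.balanced hw (by rw [add_comm, hlm]) (by rw [mul_comm m, hlm2, hdet])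
  -- This side of the node's measurement cancels the basis `v`, and `T` diagonalises `W`, so noise
  -- and Schmidt bases are aligned.
  set S : Matrix (Fin 2) (Fin 2) ℂ := ((basisMat v)ᵀ)ᴴ with hS
  have hVS : (basisMat v)ᵀ * S = 1 := basisMat_transpose_mul v
  have hSS : Sᴴ * S = 1 := by rw [hS, Matrix.conjTranspose_conjTranspose]; exact hVS
  have hstep := Attains.measure (v := fun r => tailState (Fin.succ 0) (ψ r) W)
    (Fin.castSucc (Fin.succ 0)) _ (isKrausFamily_bellOp hSS hT)
    (fun x => if x.1 = 0 then outcomeValue p δ (l / 2) (m / 2)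
      else outcomeValue p δ (m / 2) (l / 2)) ?_
  · convert hstep using 1
    -- Two outcomes give (l/2, m/2) and two give (m/2, l/2). By linearity of `outcomeValue` they add
    -- up to its value at (w, w).
    rw [Fintype.sum_prod_type, optValue_eq_outcomeValue, ← hlm]
    simp only [Fin.sum_univ_two, if_true, Fin.isValue, one_ne_zero, if_false, outcomeValue]
    ring
  · intro x
    have hN : ∀ r, ψ r (Fin.castSucc 0) * bellOp S T x * W =
        basisMat u * noisyMat p δ r * (bellOp 1 T x * W) := by
      intro r
      rw [Fin.castSucc_zero, hψ, noisySegment, bellOp_mul_left, Matrix.mul_assoc _ _ S, hVS,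
        ← bellOp_mul_left, Matrix.mul_assoc]
    have hNN := mul_bellOp_mul_conjTranspose 1 T W x
    rw [hTW, pauli_conj_diagonal, Matrix.one_mul, Matrix.conjTranspose_one, Matrix.mul_one] at hNN
    simp only [applyAt_collapse, hN]
    have hU := basisMat_conjTranspose_mul u
    split_ifs with hx
    · refine attains_filter hc.1 hc.2.1 ψ hU (half_pos hl) (half_pos hm) ?_ (by linarith)
      rw [hNN, if_pos hx]
      ext i j
      fin_cases i <;> fin_cases j <;> simp <;> ring
    · refine attains_filter hc.1 hc.2.1 ψ hU (half_pos hm) (half_pos hl) ?_ (by linarith)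
      rw [hNN, if_neg hx]
      ext i j
      fin_cases i <;> fin_cases j <;> simp <;> ring

/-- Swapping along a chain of pure segments. -/
lemma attains_chain {p δ c : ℝ} (hc : Sufficient p δ c) (u v : QubitBasis)
    (φ : Fin n → Matrix (Fin 2) (Fin 2) ℂ) (hφ : ∀ i, (φ i * (φ i)ᴴ).trace = 1) (k : ℕ)
    (hk : k < n) (W : Matrix (Fin 2) (Fin 2) ℂ) (w : ℝ) (hw : 0 < w) (htr : (W * Wᴴ).trace = w)
    (hdet : 4 * ‖W.det‖ ^ 2 * ∏ i : Fin n with i.val < k, (4 * ‖(φ i).det‖ ^ 2) = w ^ 2 * c) :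
    Attains (fun r => tailState (Fin.succ ⟨k, hk⟩)
      (Fin.cons (noisySegment u v p δ r) φ : Fin (n + 1) → Matrix (Fin 2) (Fin 2) ℂ) W)
      (w * optValue p δ) := by
  -- Swaps proceed from Bob towards Alice. By `hdet`, the squared concurrence of `W`, times those of
  -- the segments still to be swapped, stays equal to c.
  induction k generalizing W w with
  | zero =>
    obtain ⟨n, rfl⟩ : ∃ n', n = n' + 1 := ⟨n - 1, by omega⟩
    exact attains_last_swap hc u v _ (fun r => rfl) hw htr (by simpa using hdet)
  | succ k ih =>
    set i : Fin n := ⟨k, by omega⟩ with hi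
    obtain ⟨S, T, hS, hT, hST⟩ := exists_unbiased_swap (φ i) W
    have hstep := Attains.measure (v := fun r => tailState (Fin.succ ⟨k + 1, hk⟩)
      (Fin.cons (noisySegment u v p δ r) φ : Fin (n + 1) → Matrix (Fin 2) (Fin 2) ℂ) W)
      (Fin.castSucc (Fin.succ ⟨k + 1, hk⟩)) _ (isKrausFamily_bellOp hS hT)
      (fun _ => w / 4 * optValue p δ) ?_
    · convert hstep using 1
      rw [Finset.sum_const, Finset.card_univ, Fintype.card_prod, Fintype.card_fin, nsmul_eq_mul]
      push_cast
      ring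
    · intro x
      have hseg : ∀ r, (Fin.cons (noisySegment u v p δ r) φ :
          Fin (n + 1) → Matrix (Fin 2) (Fin 2) ℂ) (Fin.castSucc ⟨k + 1, hk⟩) = φ i := fun r => rfl
      simp only [applyAt_collapse, hseg]
      refine ih (by omega) _ _ (by positivity) ?_ ?_
      · rw [hST, hφ, htr]
        push_cast
        ring
      · have hf : (Finset.univ.filter fun j : Fin n => j.val < k + 1) =
            insert i (Finset.univ.filter fun j : Fin n => j.val < k) := by
          ext j
          simp only [Finset.mem_filter, Finset.mem_univ, true_and, Finset.mem_insert, hi,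
            Fin.ext_iff]
          omega
        rw [hf, Finset.prod_insert (by simp [hi])] at hdet
        rw [Matrix.det_mul, Matrix.det_mul, norm_mul, norm_mul, norm_det_bellOp hS hT]
        -- The weight drops from w to w/4, hence 1/16 on the right. On the left, the Bell factor
        -- (1/2)² and the factor 4 absorbed with the swapped segment give the same.
        linear_combination 1 / 16 * hdet

lemma attains_full_chain {p δ : ℝ} (u v : QubitBasis) (φ : Fin n → Matrix (Fin 2) (Fin 2) ℂ)
    (hφ : ∀ i, (φ i * (φ i)ᴴ).trace = 1)
    (hc : Sufficient p δ (∏ i, (4 * ‖(φ i).det‖ ^ 2))) :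
    Attains (fun r => tailState (Fin.last n)
      (Fin.cons (noisySegment u v p δ r) φ : Fin (n + 1) → Matrix (Fin 2) (Fin 2) ℂ)
      ((Fin.cons (noisySegment u v p δ r) φ : Fin (n + 1) → Matrix (Fin 2) (Fin 2) ℂ)
        (Fin.last n))) (optValue p δ) := by
  rcases n with _ | n
  -- Without pure segments the product is 1 and nothing is swapped: the balanced weights l = m = 1
  -- give the filter condition for S = T = 1.
  · obtain ⟨-, -, h1⟩ := hc.balanced (l := 1) (m := 1) two_pos (by norm_num) (by simp; norm_num)
    have h := attains_filter hc.1 hc.2.1 (n := 0)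
      (fun r => (Fin.cons (noisySegment u v p δ r) φ : Fin 1 → Matrix (Fin 2) (Fin 2) ℂ))
      (basisMat_conjTranspose_mul u) one_pos one_pos (N := (basisMat v)ᵀ) ?_ h1
    · rw [← one_mul (optValue p δ), optValue_eq_outcomeValue]
      exact h
    · rw [basisMat_transpose_mul]
      ext i j
      fin_cases i <;> fin_cases j <;> simp
  · have h := attains_chain hc u v φ hφ n (Nat.lt_succ_self n) (φ (Fin.last n)) 1 one_pos
      (by rw [hφ]; norm_num) ?_
    · rw [one_mul] at h
      exact h
    · have hf : insert (Fin.last n) (Finset.univ.filter fun j : Fin (n + 1) => j.val < n) =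
          Finset.univ := by
        ext j
        simp only [Finset.mem_filter, Finset.mem_univ, true_and, Finset.mem_insert, Fin.ext_iff,
          Fin.val_last, iff_true]
        omega
      rw [one_pow, one_mul]
      conv_rhs => rw [← hf, Finset.prod_insert (by simp)]

end Swap

/-! ### From Schmidt vectors and physical qubits to the protocol -/

section Assembly

variable {n : ℕ}

lemma ketMat_schmidtKet (e f : QubitBasis) (α : ℝ) :
    ketMat (schmidtKet e f α) =
      basisMat e * !![((√α : ℝ) : ℂ), 0; 0, ((√(1 - α) : ℝ) : ℂ)] * (basisMat f)ᵀ := by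
  ext a b
  simp [ketMat, schmidtKet, tensorKet, basisMat, Matrix.mul_apply, Fin.sum_univ_two]
  ring

lemma trace_ketMat_schmidtKet (e f : QubitBasis) {α : ℝ} (hα : α ∈ Set.Ico (1 / 2 : ℝ) 1) :
    (ketMat (schmidtKet e f α) * (ketMat (schmidtKet e f α))ᴴ).trace = 1 := by
  have h1 : ((√α : ℝ) : ℂ) * ((√α : ℝ) : ℂ) = α := by
    rw [← Complex.ofReal_mul, Real.mul_self_sqrt (by linarith [hα.1])]
  have h2 : ((√(1 - α) : ℝ) : ℂ) * ((√(1 - α) : ℝ) : ℂ) = 1 - α := by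
    rw [← Complex.ofReal_mul, Real.mul_self_sqrt (by linarith [hα.2])]
    push_cast
    rfl
  rw [ketMat_schmidtKet]
  set D : Matrix (Fin 2) (Fin 2) ℂ := !![((√α : ℝ) : ℂ), 0; 0, ((√(1 - α) : ℝ) : ℂ)] with hD
  have e1 : basisMat e * D * (basisMat f)ᵀ * (basisMat e * D * (basisMat f)ᵀ)ᴴ =
      basisMat e * (D * ((basisMat f)ᵀ * ((basisMat f)ᵀ)ᴴ) * Dᴴ * (basisMat e)ᴴ) := by
    simp only [Matrix.conjTranspose_mul, Matrix.mul_assoc]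
  rw [e1, basisMat_transpose_mul, Matrix.mul_one, Matrix.trace_mul_comm, Matrix.mul_assoc,
    basisMat_conjTranspose_mul, Matrix.mul_one]
  rw [Matrix.trace_fin_two, Matrix.mul_apply, Matrix.mul_apply]
  simp [hD, Fin.sum_univ_two, Matrix.conjTranspose_apply, h1, h2]

lemma nrm_schmidtKet (e f : QubitBasis) {α : ℝ} (hα : α ∈ Set.Ico (1 / 2 : ℝ) 1) :
    nrm (schmidtKet e f α) = 1 := by
  have h := trace_ketMat_schmidtKet e f hα
  have h2 : (ketMat (schmidtKet e f α) * (ketMat (schmidtKet e f α))ᴴ).trace =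
      (nrm (schmidtKet e f α) : ℂ) := by
    rw [nrm, sum_ket]
    simp only [Matrix.trace, Matrix.diag, Matrix.mul_apply, Matrix.conjTranspose_apply]
    push_cast
    refine Finset.sum_congr rfl fun a _ => Finset.sum_congr rfl fun b _ => ?_
    rw [Complex.star_def, Complex.mul_conj']
    rfl
  rw [h2] at h
  exact_mod_cast h

lemma norm_det_basisMat (u : QubitBasis) : ‖(basisMat u).det‖ = 1 :=
  norm_det_unitary (basisMat_conjTranspose_mul u)

lemma det_ketMat_schmidtKet (e f : QubitBasis) {α : ℝ} (hα : α ∈ Set.Ico (1 / 2 : ℝ) 1) :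
    4 * ‖(ketMat (schmidtKet e f α)).det‖ ^ 2 = concurrence α ^ 2 := by
  rw [ketMat_schmidtKet, Matrix.det_mul, Matrix.det_mul, Matrix.det_transpose, norm_mul, norm_mul,
    norm_det_basisMat, norm_det_basisMat, Matrix.det_fin_two_of, mul_zero, sub_zero, one_mul,
    mul_one, ← Complex.ofReal_mul, norm_ofReal_sq, concurrence,
    Real.sqrt_mul (by linarith [hα.1])]
  ring

/-- The cell of a party of the chain, with the missing qubits of the end parties reset. -/
def chainCell (k : Fin (n + 2)) (x : QubitSys (chainOwner n) k) : Cell :=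
  (Fin.cases (motive := fun k => QubitSys (chainOwner n) k → Fin 2) (fun _ => 0)
      (fun s x => x ⟨(s, 1), rfl⟩) k x,
    Fin.lastCases (motive := fun k => QubitSys (chainOwner n) k → Fin 2) (fun _ => 0)
      (fun s x => x ⟨(s, 0), rfl⟩) k x)

lemma chainCell_succ (s : Fin (n + 1)) (x : QubitSys (chainOwner n) s.succ) :
    (chainCell s.succ x).1 = x ⟨(s, 1), rfl⟩ := rfl

lemma chainCell_zero (x : QubitSys (chainOwner n) 0) : (chainCell 0 x).1 = 0 := rfl

lemma chainCell_castSucc (s : Fin (n + 1)) (x : QubitSys (chainOwner n) s.castSucc) :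
    (chainCell s.castSucc x).2 = x ⟨(s, 0), rfl⟩ := by
  simp only [chainCell, Fin.lastCases_castSucc]

lemma chainCell_last (x : QubitSys (chainOwner n) (Fin.last (n + 1))) :
    (chainCell (Fin.last (n + 1)) x).2 = 0 := by
  simp only [chainCell, Fin.lastCases_last]

lemma chainCell_injective (k : Fin (n + 2)) : Function.Injective (chainCell (n := n) k) := by
  intro x x' h
  funext ⟨⟨s, i⟩, hq⟩
  subst hq
  fin_cases i
  · have h1 := congrArg Prod.snd h
    exact (chainCell_castSucc s x).symm.trans (h1.trans (chainCell_castSucc s x'))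
  · exact congrArg Prod.fst h

lemma chainCell_surjective (y : Fin (n + 2) → Cell) (h0 : (y 0).1 = 0)
    (h1 : (y (Fin.last (n + 1))).2 = 0) :
    ∃ x : ∀ k, QubitSys (chainOwner n) k, (fun k => chainCell k (x k)) = y := by
  refine ⟨fun k q => if q.1.2 = 0 then (y k).2 else (y k).1, funext fun k => Prod.ext ?_ ?_⟩
  · cases k using Fin.cases with
    | zero => rw [h0]; rfl
    | succ s => simp [chainCell_succ]
  · cases k using Fin.lastCases with
    | last => rw [h1, chainCell_last]
    | cast s => simp [chainCell_castSucc]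

lemma ket_eq_ketMat (ψ : Ket2) (w : Fin 2 → Fin 2) : ψ w = ketMat ψ (w 0) (w 1) := by
  simp only [ketMat, Matrix.of_apply]
  congr 1
  funext i
  fin_cases i <;> rfl

lemma exists_chain_protocol {p δ : ℝ} (u v : QubitBasis) (φ : Fin n → Ket2)
    (hφ : ∀ i, (ketMat (φ i) * (ketMat (φ i))ᴴ).trace = 1)
    (hc : Sufficient p δ (∏ i, (4 * ‖(ketMat (φ i)).det‖ ^ 2))) :
    ∃ Λ : Matrix (∀ k, QubitSys (chainOwner n) k) (∀ k, QubitSys (chainOwner n) k) ℂ →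
      Matrix (∀ k, QubitSys ![0, Fin.last (n + 1)] k) (∀ k, QubitSys ![0, Fin.last (n + 1)] k) ℂ,
      IsLOCC Λ ∧ ∃ e f : QubitBasis, fid (schmidtKet e f (1 / 2))
        (collect ![0, Fin.last (n + 1)] (Λ (distribute (chainOwner n)
          (chainState (Fin.cons (noisyState u v p δ) fun i => ketbra (φ i)))))) =
        optValue p δ := by
  have hω := chainState_cons_sum (noisyKet u v p δ) φ
  rw [← noisyState_eq_sum u v hc.1] at hω
  refine Attains.isometry hω chainCell chainCell_injective ?_ ?_
    (attains_full_chain u v (fun i => ketMat (φ i)) hφ hc)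
  · intro r x
    rw [tailState_last, if_pos ⟨chainCell_zero _, chainCell_last _⟩]
    refine Finset.prod_congr rfl fun s _ => ?_
    rw [chainCell_castSucc, chainCell_succ]
    refine Eq.trans ?_ (ket_eq_ketMat _ _).symm
    have hs : (Fin.cons (noisySegment u v p δ r) fun i => ketMat (φ i) :
        Fin (n + 1) → Matrix (Fin 2) (Fin 2) ℂ) s =
        ketMat ((Fin.cons (noisyKet u v p δ r) φ : Fin (n + 1) → Ket2) s) := by
      cases s using Fin.cases with
      | zero => exact (ketMat_noisyKet u v p δ r).symm
      | succ i => rfl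
    rw [hs]
    rfl
  · intro r y hy
    rw [tailState_last, if_neg]
    rintro ⟨h0, h1⟩
    obtain ⟨x, hx⟩ := chainCell_surjective y h0 h1
    exact hy x hx

/-- The cell of a party that shares a single pair of qubits. -/
def pairCell (k : Fin 2) (x : QubitSys (id : Fin 2 → Fin 2) k) : Cell :=
  if k = 0 then (0, x ⟨k, rfl⟩) else (x ⟨k, rfl⟩, 0)

/-- The two-party problem is the chain without intermediate nodes, up to a different labelling of
the qubits. -/
lemma exists_pair_protocol {p δ : ℝ} (u v : QubitBasis) (hc : Sufficient p δ 1) :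
    ∃ Λ : Matrix (∀ k, QubitSys (id : Fin 2 → Fin 2) k) (∀ k, QubitSys (id : Fin 2 → Fin 2) k) ℂ →
      Matrix (∀ k, QubitSys ![(0 : Fin 2), 1] k) (∀ k, QubitSys ![(0 : Fin 2), 1] k) ℂ,
      IsLOCC Λ ∧ ∃ e f : QubitBasis, fid (schmidtKet e f (1 / 2))
        (collect ![0, 1] (Λ (distribute id (noisyState u v p δ)))) = optValue p δ := by
  refine Attains.isometry (n := 0) (owner := (id : Fin 2 → Fin 2))
    (noisyState_eq_sum u v hc.1) pairCell ?_ ?_ ?_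
    (attains_full_chain (n := 0) u v Fin.elim0 (fun i => i.elim0) (by simpa using hc))
  · intro k x x' h
    funext ⟨q, hq⟩
    change q = k at hq
    subst hq
    fin_cases q <;> simpa [pairCell] using h
  · intro r x
    have h0 : (pairCell 0 (x 0)).1 = 0 := rfl
    have h1 : (pairCell 1 (x 1)).2 = 0 := rfl
    rw [tailState_last, if_pos ⟨h0, h1⟩]
    refine Eq.trans ?_ (ket_eq_ketMat _ _).symm
    rw [ketMat_noisyKet]
    simp only [Fin.prod_univ_succ, Finset.univ_eq_empty, Finset.prod_empty, mul_one]
    rfl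
  · intro r y hy
    rw [tailState_last, if_neg]
    rintro ⟨h0, h1⟩
    refine hy (fun k _ => if k = 0 then (y k).2 else (y k).1) (funext fun k => ?_)
    fin_cases k
    · exact Prod.ext h0.symm rfl
    · exact Prod.ext rfl h1.symm

end Assembly

end Repeater

end

theorem corollary1 (n : ℕ) (α : Fin n → ℝ) (hα : ∀ i, α i ∈ Set.Ico (1 / 2 : ℝ) 1) :
    (interior (Repeater.noiseRegion α)).Nonempty ∧
    ∀ p δ : ℝ, (p, δ) ∈ Repeater.noiseRegion α →
      ∀ (u v : Repeater.QubitBasis) (e f : Fin n → Repeater.QubitBasis),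
        Repeater.chainOFEF
            (Repeater.segmentStates (Repeater.noisyState u v p δ) e f α) =
          Repeater.ofef (Repeater.noisyState u v p δ) ∧
        Repeater.ofef (Repeater.noisyState u v p δ) ∈
          Repeater.chainAchievableFEF
            (Repeater.segmentStates (Repeater.noisyState u v p δ) e f α) := by
  refine ⟨Repeater.interior_noiseRegion_nonempty α hα, ?_⟩
  rintro p δ ⟨hp, hδ, hle⟩ u v e f
  have hpos : 0 < ∏ i, Repeater.concurrence (α i) ^ 2 :=
    Finset.prod_pos fun i _ => pow_pos (Repeater.concurrence_pos (hα i)) 2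
  -- The condition at c = 1 is the weakest, since its square root vanishes; every point of the
  -- region satisfies it.
  have hpair : Repeater.Sufficient p δ 1 := by
    refine ⟨hp, hδ, one_pos, le_trans ?_ hle⟩
    rw [sub_self, Real.sqrt_zero]
    linarith [Real.sqrt_nonneg (1 - ∏ i, Repeater.concurrence (α i) ^ 2)]
  have hchain : Repeater.Sufficient p δ
      (∏ i, (4 * ‖(Repeater.ketMat (Repeater.schmidtKet (e i) (f i) (α i))).det‖ ^ 2)) := by
    simp only [Repeater.det_ketMat_schmidtKet _ _ (hα _)]
    exact ⟨hp, hδ, hpos, hle⟩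
  have h1 := Repeater.sSup_achievableFEF
    (fun Λ hΛ e' f' => Repeater.pair_fid_le u v hp hδ hΛ e' f')
    (Repeater.exists_pair_protocol u v hpair)
  have h2 := Repeater.sSup_achievableFEF
    (fun Λ hΛ e' f' => Repeater.chain_fid_le u v hp hδ
      (fun i => Repeater.schmidtKet (e i) (f i) (α i))
      (fun i => Repeater.nrm_schmidtKet _ _ (hα i)) hΛ e' f')
    (Repeater.exists_chain_protocol u v (fun i => Repeater.schmidtKet (e i) (f i) (α i))
      (fun i => Repeater.trace_ketMat_schmidtKet _ _ (hα i)) hchain)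
  have e1 : Repeater.ofef (Repeater.noisyState u v p δ) = Repeater.optValue p δ := h1.2
  rw [e1]
  exact ⟨h2.2, h2.1⟩
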